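/- Let $\alpha>0$ and $p>5$ be real numbers. Write points of $\mathbb{R}^3$ as $(x_1,x_2,y)$, put $x=(x_1,x_2)$ and $|x|=\sqrt{x_1^2+x_2^2}$. Let $\Omega\subset\mathbb{R}^3$ be a bounded domain with $C^\infty$ boundary and outward unit normal $\nu=(\nu_1,\nu_2,\nu_3)$. Assume that $\Omega$ is $G_\alpha$-star-shaped with respect to the origin, that is, $(0,0,0)\in\Omega$ and $$x_1\nu_1+x_2\nu_2+(1+\alpha)\,y\,\nu_3\ \ge\ 0\qquad\text{at every point of }\partial\Omega .$$ Let $\mathcal{S}_2(\overline\Omega)$ be the space of real functions $u\in C^1(\overline\Omega)$ with $u=0$ on $\partial\Omega$ such that the distributions $\frac{\partial^2u}{\partial x_1^2}$, $\frac{\partial^2u}{\partial x_2^2}$ and $|x|^{2\alpha}\frac{\partial^2u}{\partial y^2}$ on $\Omega$ are continuous functions in $\Omega$ that extend continuously to $\overline\Omega$. Here $C^1(\overline\Omega)$ means continuous on $\overline\Omega$ and $C^1$ in $\Omega$ with first partial derivatives extending continuously to $\overline\Omega$, and $|x|^{2\alpha}\frac{\partial^2u}{\partial y^2}$ denotes the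 distribution $\frac{\partial^2}{\partial y^2}\big(|x|^{2\alpha}u\big)$. Then the problem $$-\frac{\partial^2u}{\partial x_1^2}-\frac{\partial^2u}{\partial x_2^2}-|x|^{2\alpha}\frac{\partial^2u}{\partial y^2}=|x|^{2\alpha}|u|^{p-1}u\ \text{ in }\Omega,\qquad u=0\ \text{ on }\partial\Omega,$$ has no nontrivial solution $u\in\mathcal{S}_2(\overline\Omega)$; that is, the only solution in $\mathcal{S}_2(\overline\Omega)$ is $u\equiv 0$ on $\overline\Omega$. -/

import Mathlib

open MeasureTheory Set TopologicalSpace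
open scoped ContDiff Distributions

noncomputable section

namespace Grushin

/-- Points `(x₁, x₂, y)` of `ℝ³`: the coordinates `0`, `1` are `x₁`, `x₂`, the coordinate `2` is `y`. -/
abbrev Space3 : Type := EuclideanSpace ℝ (Fin 3)

/-- `|x| = √(x₁² + x₂²)` at the point `(x₁, x₂, y)`. -/
def horizontalNorm (z : Space3) : ℝ := Real.sqrt (z 0 ^ 2 + z 1 ^ 2)

/-- The weight `|x|^{2α}`. -/
def weight (α : ℝ) (z : Space3) : ℝ := horizontalNorm z ^ (2 * α)

/-- `ρ` is a smooth defining function of `Ω` in the open neighbourhood `U` of the point `z`: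
inside `U` the set `Ω` is `{ρ < 0}`, and `∇ρ(z) ≠ 0`. -/
structure IsLocalDefiningFunction (Ω : Set Space3) (z : Space3) (U : Set Space3)
    (ρ : Space3 → ℝ) : Prop where
  isOpen : IsOpen U
  mem : z ∈ U
  smooth : ContDiffOn ℝ ∞ ρ U
  inter_eq : Ω ∩ U = {w | ρ w < 0} ∩ U
  gradient_ne_zero : gradient ρ z ≠ 0

/-- A bounded smooth domain of `ℝ³`: the open set `Ω` is connected (so nonempty) and bounded, with
`C^∞` boundary, and lies locally on one side of the boundary. -/
structure IsBoundedSmoothDomain (Ω : Opens Space3) : Prop where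
  isConnected : IsConnected (Ω : Set Space3)
  isBounded : Bornology.IsBounded (Ω : Set Space3)
  smooth_boundary : ∀ z ∈ frontier (Ω : Set Space3), ∃ U ρ, IsLocalDefiningFunction Ω z U ρ

/-- `ν` is the outward unit normal to `∂Ω` at the boundary point `z`, that is,
`ν = ∇ρ(z) / ‖∇ρ(z)‖` for a local defining function `ρ`. -/
def IsOutwardUnitNormal (Ω : Set Space3) (z ν : Space3) : Prop :=
  ∃ U ρ, IsLocalDefiningFunction Ω z U ρ ∧ ν = ‖gradient ρ z‖⁻¹ • gradient ρ z

/-- `G_α`-star-shapedness with respect to the origin. -/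
def IsStarShaped (α : ℝ) (Ω : Opens Space3) : Prop :=
  (0 : Space3) ∈ Ω ∧ ∀ z ∈ frontier (Ω : Set Space3), ∀ ν, IsOutwardUnitNormal Ω z ν →
    0 ≤ z 0 * ν 0 + z 1 * ν 1 + (1 + α) * z 2 * ν 2

/-- The classical partial derivative in the `i`-th coordinate. -/
def partialDeriv (i : Fin 3) (u : Space3 → ℝ) (z : Space3) : ℝ :=
  fderiv ℝ u z (EuclideanSpace.single i 1)

/-- The second derivative `∂ᵢ²v` in the sense of distributions on `Ω` is the function `g`. -/
def IsDistribSecondDeriv (Ω : Opens Space3) (i : Fin 3) (v g : Space3 → ℝ) : Prop :=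
  ∀ φ : 𝓓(Ω, ℝ),
    ∫ z in Ω, v z * partialDeriv i (partialDeriv i φ) z = ∫ z in Ω, g z * φ z

/-- Membership in `C¹₀(Ω̄)`: `u` is continuous on `Ω̄`, of class `C¹` in `Ω`, its first partial
derivatives extend continuously to `Ω̄`, and `u = 0` on `∂Ω`. -/
structure MemC10 (Ω : Opens Space3) (u : Space3 → ℝ) : Prop where
  continuousOn : ContinuousOn u (closure (Ω : Set Space3))
  contDiffOn : ContDiffOn ℝ 1 u Ω
  partialDeriv_extends : ∀ i, ∃ G : Space3 → ℝ,
    ContinuousOn G (closure (Ω : Set Space3)) ∧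
    EqOn G (partialDeriv i u) Ω
  eq_zero_of_mem_frontier : ∀ z ∈ frontier (Ω : Set Space3), u z = 0

/-- `g₁, g₂, g₃` are the continuous extensions to `Ω̄` of the distributions `∂²u/∂x₁²`, `∂²u/∂x₂²`
and `|x|^{2α} ∂²u/∂y²` on `Ω`. Since `|x|^{2α}` does not depend on `y`, the last distribution
is `∂²(|x|^{2α} u)/∂y²`; in this form no smoothness of the weight is needed. -/
structure AreSecondDerivs (α : ℝ) (Ω : Opens Space3) (u g₁ g₂ g₃ : Space3 → ℝ) : Prop where
  continuousOn₁ : ContinuousOn g₁ (closure (Ω : Set Space3))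
  continuousOn₂ : ContinuousOn g₂ (closure (Ω : Set Space3))
  continuousOn₃ : ContinuousOn g₃ (closure (Ω : Set Space3))
  deriv₁ : IsDistribSecondDeriv Ω 0 u g₁
  deriv₂ : IsDistribSecondDeriv Ω 1 u g₂
  deriv₃ : IsDistribSecondDeriv Ω 2 (fun z => weight α z * u z) g₃

/-- Membership in `S₂(Ω̄)`. -/
def MemS2 (α : ℝ) (Ω : Opens Space3) (u : Space3 → ℝ) : Prop :=
  MemC10 Ω u ∧ ∃ g₁ g₂ g₃, AreSecondDerivs α Ω u g₁ g₂ g₃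

/-- `u` solves `-Δₓu - |x|^{2α} ∂²u/∂y² = f(·, u)` in `Ω`, `u = 0` on `∂Ω`, where the second
derivatives are the continuous functions that represent the distributional ones. -/
def IsSolution (α : ℝ) (Ω : Opens Space3) (f : Space3 → ℝ → ℝ) (u : Space3 → ℝ) : Prop :=
  (∃ g₁ g₂ g₃, AreSecondDerivs α Ω u g₁ g₂ g₃ ∧
    ∀ z ∈ Ω, -(g₁ z + g₂ z) - g₃ z = f z (u z)) ∧
  ∀ z ∈ frontier (Ω : Set Space3), u z = 0

end Grushin

end

/-! This is a Pohozaev argument with the infinitesimal dilation replaced by finite ones. The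
classical proof multiplies the equation by `Xu`, where `X = x·∇ₓ + (1 + α) y ∂_y`. For `u` in the
present class `Xu` is only known to be continuous and need not vanish on the boundary. Instead,
extend `u` by zero to `v` and test the weak equation with `v ∘ δ_s`, where `δ_s (x, y) = (s x,
s^(1+α) y)` and `s ≥ 1`. No boundary integral appears.

The test is legitimate because star-shapedness gives `δ_s⁻¹ Ω ⊆ Ω` (`mem_of_dil_mem`). Since `v` is
`C¹` only inside `Ω`, truncating its values near zero reduces the test to compactly supported `C¹`
functions (`weak_equation_of_eq_zero`).

Put `a = 1 + α`, `E = ∫ |x|^{2α} |v|^{p+1}` and `Q = |∇ₓv|² + |x|^{2α} |∂_y v|²`. Testing with `s =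
1` gives `∫ Q = E`. For general `s`, Young's inequality and the scaling of `Q` bound `∫ |x|^{2α}
|v|^{p-1} v (v ∘ δ_s)` above by `(1 + s^(-a)) E / 2`. A first-order expansion of the power, with
quadratic error because `v` is Lipschitz, bounds it below by `E - (1 - s^(-3a)) E / (p + 1) - O((s -
1)²)`. Comparing first-order terms at `s = 1` gives `a E / 2 ≤ 3 a E / (p + 1)`, so `E ≤ 0` when `p
> 5` (`energy_nonpos`). As `E ≥ 0` and the weight vanishes only on the axis `x = 0`, `v` is zero. -/

namespace Grushin

open Filter Topology

/-! ### Anisotropic dilations and their flow -/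

/-- The linear map of `ℝ³` that multiplies the `i`-th coordinate by `c i`. -/
noncomputable def diagMap (c : Fin 3 → ℝ) : Space3 →L[ℝ] Space3 :=
  Matrix.toEuclideanCLM (n := Fin 3) (𝕜 := ℝ) (Matrix.diagonal c)

@[simp]
theorem diagMap_apply (c : Fin 3 → ℝ) (z : Space3) (i : Fin 3) : diagMap c z i = c i * z i := by
  change (Matrix.mulVec (Matrix.diagonal c) z.ofLp) i = _
  rw [Matrix.mulVec_diagonal]

/-- The factors of the anisotropic dilation `(x, y) ↦ (s x, s^(1 + α) y)`. -/
noncomputable def dilFactor (α s : ℝ) : Fin 3 → ℝ := ![s, s, s ^ (1 + α)]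

/-- The anisotropic dilation `(x, y) ↦ (s x, s^(1 + α) y)`. -/
noncomputable def dil (α s : ℝ) : Space3 →L[ℝ] Space3 := diagMap (dilFactor α s)

/-- The generator `(x, y) ↦ (x, (1 + α) y)` of the anisotropic dilations. -/
noncomputable def dilGen (α : ℝ) : Space3 →L[ℝ] Space3 := diagMap ![1, 1, 1 + α]

theorem dil_one (α : ℝ) (z : Space3) : dil α 1 z = z := by
  ext i
  fin_cases i <;> simp [dil, dilFactor]

/-- In exponential time the dilations are the flow of the field `dilGen α`, whose product with `ν`
is the expression in the star-shapedness condition. -/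
theorem hasDerivAt_dil_exp (α : ℝ) (z : Space3) (t : ℝ) :
    HasDerivAt (fun t => dil α (Real.exp t) z) (dilGen α (dil α (Real.exp t) z)) t := by
  have key : ∀ t, dil α (Real.exp t) z =
      Real.exp t • diagMap ![1, 1, 0] z + Real.exp (t * (1 + α)) • diagMap ![0, 0, 1] z := by
    intro t
    ext i
    fin_cases i <;> simp [dil, dilFactor, Real.exp_mul]
  have h2 : HasDerivAt (fun t : ℝ => Real.exp (t * (1 + α)))
      (Real.exp (t * (1 + α)) * (1 * (1 + α))) t := ((hasDerivAt_id t).mul_const (1 + α)).exp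
  have h := ((Real.hasDerivAt_exp t).smul_const (diagMap ![1, 1, 0] z)).add
    (h2.smul_const (diagMap ![0, 0, 1] z))
  simp_rw [key]
  refine h.congr_deriv ?_
  ext i
  fin_cases i <;> simp [dilGen]
  ring

/-! ### Star-shaped domains are stable under contraction -/

theorem fderiv_apply_eq_inner_gradient (ρ : Space3 → ℝ) (z v : Space3) :
    fderiv ℝ ρ z v = inner ℝ (gradient ρ z) v := by
  rw [← toDual_gradient, InnerProductSpace.toDual_apply_apply]

theorem IsLocalDefiningFunction.eq_zero_of_mem_frontier {Ω : Opens Space3} {ζ : Space3}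
    {U : Set Space3} {ρ : Space3 → ℝ} (h : IsLocalDefiningFunction Ω ζ U ρ)
    (hζ : ζ ∈ frontier (Ω : Set Space3)) : ρ ζ = 0 := by
  have hc : ContinuousAt ρ ζ := (h.smooth.contDiffAt (h.isOpen.mem_nhds h.mem)).continuousAt
  apply le_antisymm
  · by_contra! hpos
    have h1 : ∀ᶠ w in 𝓝 ζ, 0 < ρ w := hc.eventually (lt_mem_nhds hpos)
    have h2 := (mem_closure_iff_frequently.1 hζ.1).and_eventually
      (h1.and (h.isOpen.mem_nhds h.mem))
    obtain ⟨w, hw1, hw2, hw3⟩ := h2.exists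
    have : w ∈ {w | ρ w < 0} ∩ U := h.inter_eq ▸ ⟨hw1, hw3⟩
    exact absurd this.1 (not_lt.2 hw2.le)
  · by_contra! hneg
    have : ζ ∈ (Ω : Set Space3) ∩ U := h.inter_eq ▸ ⟨hneg, h.mem⟩
    rw [Ω.isOpen.frontier_eq] at hζ
    exact hζ.2 this.1

/-- If `ρ` is a smooth defining function at a boundary point of a star-shaped set, then the
derivative of `ρ` along the dilations is bounded below by a multiple of `ρ` inside the set. -/
theorem IsLocalDefiningFunction.exists_mul_le_fderiv_dilGen {α : ℝ} {Ω : Opens Space3}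
    (hstar : IsStarShaped α Ω) {ζ : Space3} {U : Set Space3} {ρ : Space3 → ℝ}
    (h : IsLocalDefiningFunction Ω ζ U ρ) (hζ : ζ ∈ frontier (Ω : Set Space3)) :
    ∃ K : ℝ, ∀ᶠ z in 𝓝 ζ, ρ z < 0 → K * ρ z ≤ fderiv ℝ ρ z (dilGen α z) := by
  have hsm : ∀ z ∈ U, ContDiffAt ℝ ∞ ρ z := fun z hz => h.smooth.contDiffAt (h.isOpen.mem_nhds hz)
  have hU := h.isOpen.mem_nhds h.mem
  have h0 := h.eq_zero_of_mem_frontier hζ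
  have hdiff : ∀ z ∈ U, DifferentiableAt ℝ ρ z := fun z hz => (hsm z hz).differentiableAt (by simp)
  have hfd : ContDiffAt ℝ 1 (fderiv ℝ ρ) ζ :=
    (hsm ζ h.mem).fderiv_right (m := 1) (by norm_cast)
  -- This function is nonnegative at nearby boundary points and Lipschitz near `ζ`. At an interior
  -- point it is therefore at least `-L` times the distance to a boundary point, and that distance
  -- is controlled by `|ρ z|`.
  have hT : ContDiffAt ℝ 1 (fun z => fderiv ℝ ρ z (dilGen α z)) ζ :=
    hfd.clm_apply (dilGen α).contDiff.contDiffAt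
  obtain ⟨L, V, hV, hL⟩ := hT.exists_lipschitzOnWith
  set n := gradient ρ ζ with hn
  have hnpos : 0 < ‖n‖ := norm_pos_iff.2 h.gradient_ne_zero
  have hgn : fderiv ℝ ρ ζ n = ‖n‖ ^ 2 := by
    rw [← real_inner_self_eq_norm_sq, hn, fderiv_apply_eq_inner_gradient]
  -- At `ζ` the derivative of `ρ` along `n` is `‖n‖ ^ 2`; half of it survives nearby, so `ρ` grows
  -- at rate at least `c` along `n`.
  set c := ‖n‖ ^ 2 / 2 with hc
  have hcpos : 0 < c := by positivity
  have hn2 : ∀ᶠ z in 𝓝 ζ, c < fderiv ℝ ρ z n := by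
    have : ContinuousAt (fun z => fderiv ℝ ρ z n) ζ :=
      hfd.continuousAt.clm_apply continuousAt_const
    refine this.eventually (lt_mem_nhds ?_)
    change c < fderiv ℝ ρ ζ n
    rw [hgn, hc]; linarith
  obtain ⟨r, hr, hball⟩ := Metric.eventually_nhds_iff_ball.1
    (hn2.and ((eventually_mem_set.2 hV).and (eventually_mem_set.2 hU)))
  have hρc : ContinuousAt ρ ζ := (hsm ζ h.mem).continuousAt
  -- Moving from `z` along `n` for time `|ρ z| / c` suffices to reach `ρ = 0`; this keeps the whole
  -- segment in the ball.
  have hcl : ∀ᶠ z in 𝓝 ζ, dist z ζ + |ρ z| / c * ‖n‖ < r := by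
    have : ContinuousAt (fun z => dist z ζ + |ρ z| / c * ‖n‖) ζ := by fun_prop
    refine this.eventually (gt_mem_nhds ?_)
    simpa [h0] using hr
  refine ⟨L * (‖n‖ / c), hcl.mono fun z hz hneg => ?_⟩
  set S := -ρ z / c with hS
  have hSpos : 0 < S := div_pos (by linarith) hcpos
  have hmem : ∀ s ∈ Icc (0 : ℝ) S, z + s • n ∈ Metric.ball ζ r := by
    intro s hs
    rw [Metric.mem_ball, dist_eq_norm, show z + s • n - ζ = (z - ζ) + s • n by abel]
    refine lt_of_le_of_lt (norm_add_le _ _) (lt_of_le_of_lt ?_ hz)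
    rw [dist_eq_norm, norm_smul, Real.norm_eq_abs, abs_of_nonneg hs.1, abs_of_neg hneg]
    gcongr
    exact hs.2
  have hder : ∀ s ∈ Icc (0 : ℝ) S,
      HasDerivAt (fun s : ℝ => ρ (z + s • n)) (fderiv ℝ ρ (z + s • n) n) s := by
    intro s hs
    have h1 := (hdiff _ (hball _ (hmem s hs)).2.2).hasFDerivAt
    have h2 : HasDerivAt (fun s : ℝ => z + s • n) n s := by
      simpa using ((hasDerivAt_id s).smul_const n).const_add z
    exact h1.comp_hasDerivAt s h2
  have hcont : ContinuousOn (fun s : ℝ => ρ (z + s • n)) (Icc 0 S) :=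
    fun s hs => (hder s hs).continuousAt.continuousWithinAt
  have hmono : StrictMonoOn (fun s : ℝ => ρ (z + s • n)) (Icc 0 S) := by
    refine strictMonoOn_of_deriv_pos (convex_Icc _ _) hcont fun s hs => ?_
    rw [interior_Icc] at hs
    rw [(hder s (Ioo_subset_Icc_self hs)).deriv]
    exact hcpos.trans (hball _ (hmem s (Ioo_subset_Icc_self hs))).1
  have hend : 0 ≤ ρ (z + S • n) := by
    have := (convex_Icc 0 S).mul_sub_le_image_sub_of_le_deriv hcont
      (fun s hs => (hder s (interior_subset hs)).differentiableAt.differentiableWithinAt)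
      (C := c) (fun s hs => by
        rw [(hder s (interior_subset hs)).deriv]
        exact (hball _ (hmem s (interior_subset hs))).1.le)
      0 (left_mem_Icc.2 hSpos.le) S (right_mem_Icc.2 hSpos.le) hSpos.le
    simp only [sub_zero, zero_smul, add_zero] at this
    have h3 : c * S = -ρ z := by rw [hS]; field_simp
    linarith
  obtain ⟨s, hs, hs0⟩ : ∃ s ∈ Icc (0 : ℝ) S, ρ (z + s • n) = 0 := by
    have := intermediate_value_Icc hSpos.le hcont
    exact this ⟨by simpa using hneg.le, hend⟩
  have hspos : 0 < s := by
    rcases hs.1.eq_or_lt with h1 | h1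
    · rw [← h1] at hs0; simp at hs0; linarith
    · exact h1
  set z' := z + s • n with hz'
  have hz'b := hball _ (hmem s hs)
  -- By strict monotonicity `ρ < 0` before time `s`, so `z'` is a limit of points of `Ω`, while `ρ
  -- z' = 0` keeps it outside.
  have hfr : z' ∈ frontier (Ω : Set Space3) := by
    rw [Ω.isOpen.frontier_eq]
    constructor
    · have hsub : (fun s : ℝ => z + s • n) '' Ico 0 s ⊆ Ω := by
        rintro _ ⟨t, ht, rfl⟩
        have ht' : t ∈ Icc (0 : ℝ) S := ⟨ht.1, ht.2.le.trans hs.2⟩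
        have : z + t • n ∈ {w | ρ w < 0} ∩ U :=
          ⟨by have := hmono ht' hs ht.2; simp only at this; rw [hs0] at this; exact this,
            (hball _ (hmem t ht')).2.2⟩
        rw [← h.inter_eq] at this
        exact this.1
      have hcts : Continuous (fun s : ℝ => z + s • n) := by fun_prop
      refine closure_mono hsub (image_closure_subset_closure_image hcts ⟨s, ?_, rfl⟩)
      rw [closure_Ico hspos.ne]
      exact right_mem_Icc.2 hspos.le
    · intro hmemΩ
      have : z' ∈ {w | ρ w < 0} ∩ U := h.inter_eq ▸ ⟨hmemΩ, hz'b.2.2⟩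
      exact absurd this.1 (by simp [hs0])
  have hgrad : gradient ρ z' ≠ 0 := by
    intro h1
    have h2 := hz'b.1
    have h3 : fderiv ℝ ρ z' n = 0 := by
      rw [fderiv_apply_eq_inner_gradient, h1]; simp
    linarith
  have hloc : IsLocalDefiningFunction Ω z' U ρ := ⟨h.isOpen, hz'b.2.2, h.smooth, h.inter_eq, hgrad⟩
  have hT' : 0 ≤ fderiv ℝ ρ z' (dilGen α z') := by
    have h1 := hstar.2 z' hfr _ ⟨U, ρ, hloc, rfl⟩
    have h2 : fderiv ℝ ρ z' (dilGen α z') = ‖gradient ρ z'‖ *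
        (z' 0 * (‖gradient ρ z'‖⁻¹ • gradient ρ z') 0 +
          z' 1 * (‖gradient ρ z'‖⁻¹ • gradient ρ z') 1 +
          (1 + α) * z' 2 * (‖gradient ρ z'‖⁻¹ • gradient ρ z') 2) := by
      have h3 : ‖gradient ρ z'‖ ≠ 0 := norm_ne_zero_iff.2 hgrad
      rw [fderiv_apply_eq_inner_gradient, PiLp.inner_apply, Fin.sum_univ_three]
      simp [dilGen]
      field_simp
    rw [h2]
    exact mul_nonneg (norm_nonneg _) h1
  have hlip := hL.dist_le_mul z (hball z (by simpa using hmem 0 (left_mem_Icc.2 hSpos.le))).2.1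
    z' hz'b.2.1
  rw [Real.dist_eq] at hlip
  have hd : dist z z' ≤ S * ‖n‖ := by
    rw [hz', dist_self_add_right, norm_smul, Real.norm_eq_abs, abs_of_pos hspos]
    gcongr
    exact hs.2
  have hd2 : (L : ℝ) * dist z z' ≤ L * (S * ‖n‖) := by gcongr
  have := (abs_le.1 hlip).1
  have h5 : (L : ℝ) * (S * ‖n‖) = -(L * (‖n‖ / c) * ρ z) := by rw [hS]; field_simp
  linarith

/-- A star-shaped smooth domain is stable under the anisotropic contractions. -/
theorem mem_of_dil_mem {α : ℝ} {Ω : Opens Space3} (hΩ : IsBoundedSmoothDomain Ω)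
    (hstar : IsStarShaped α Ω) {s : ℝ} (hs : 1 ≤ s) {z : Space3} (hz : dil α s z ∈ Ω) :
    z ∈ Ω := by
  by_contra hz0
  set γ : ℝ → Space3 := fun t => dil α (Real.exp t) z with hγ
  have hγd : ∀ t, HasDerivAt γ (dilGen α (γ t)) t := hasDerivAt_dil_exp α z
  have hγc : Continuous γ := continuous_iff_continuousAt.2 fun t => (hγd t).continuousAt
  set t₁ := Real.log s with ht₁
  have ht₁0 : 0 ≤ t₁ := Real.log_nonneg hs
  have hγ1 : γ t₁ ∈ Ω := by simpa [hγ, ht₁, Real.exp_log (by linarith : 0 < s)] using hz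
  have hγ0 : γ 0 ∉ Ω := by simpa [hγ, dil_one] using hz0
  set A : Set ℝ := Icc 0 t₁ ∩ γ ⁻¹' (Ω : Set Space3)ᶜ with hA
  have hAc : IsCompact A := isCompact_Icc.inter_right
    ((isClosed_compl_iff.2 Ω.isOpen).preimage hγc)
  have hAne : A.Nonempty := ⟨0, ⟨le_rfl, ht₁0⟩, hγ0⟩
  -- The last time at which the trajectory is outside `Ω`; it lies on the boundary then and inside
  -- immediately after.
  set t₀ := sSup A
  have ht₀ : t₀ ∈ A := hAc.sSup_mem hAne
  have ht₀1 : t₀ < t₁ := by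
    rcases ht₀.1.2.eq_or_lt with h1 | h1
    · exact absurd hγ1 (h1 ▸ ht₀.2)
    · exact h1
  have hin : ∀ t ∈ Ioc t₀ t₁, γ t ∈ Ω := by
    intro t ht
    by_contra hn
    exact absurd (le_csSup hAc.bddAbove (⟨⟨ht₀.1.1.trans ht.1.le, ht.2⟩, hn⟩ : t ∈ A))
      (not_le.2 ht.1)
  have hfr : γ t₀ ∈ frontier (Ω : Set Space3) := by
    rw [Ω.isOpen.frontier_eq]
    refine ⟨?_, ht₀.2⟩
    have hsub : γ '' Ioc t₀ t₁ ⊆ Ω := by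
      rintro _ ⟨t, ht, rfl⟩
      exact hin t ht
    refine closure_mono hsub (image_closure_subset_closure_image hγc ⟨t₀, ?_, rfl⟩)
    rw [closure_Ioc ht₀1.ne]
    exact left_mem_Icc.2 ht₀1.le
  obtain ⟨U, ρ, hρ⟩ := hΩ.smooth_boundary _ hfr
  obtain ⟨K, hK⟩ := hρ.exists_mul_le_fderiv_dilGen hstar hfr
  have hev := hγc.continuousAt.eventually (hK.and (hρ.isOpen.mem_nhds hρ.mem))
  obtain ⟨δ, hδ, hball⟩ := Metric.eventually_nhds_iff_ball.1 hev
  set t₂ := min t₁ (t₀ + δ / 2)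
  have ht₂ : t₀ < t₂ := lt_min ht₀1 (by linarith)
  have hball' : ∀ t ∈ Icc t₀ t₂, t ∈ Metric.ball t₀ δ := by
    intro t ht
    have : t ≤ t₀ + δ / 2 := ht.2.trans (min_le_right _ _)
    rw [Metric.mem_ball, Real.dist_eq, abs_of_nonneg (by linarith [ht.1])]
    linarith
  have hneg : ∀ t ∈ Ioc t₀ t₂, ρ (γ t) < 0 := by
    intro t ht
    have : γ t ∈ (Ω : Set Space3) ∩ U :=
      ⟨hin t ⟨ht.1, ht.2.trans (min_le_left _ _)⟩, (hball t (hball' t ⟨ht.1.le, ht.2⟩)).2⟩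
    rw [hρ.inter_eq] at this
    exact this.1
  -- Star-shapedness is not strict, so the flow may be tangent to the boundary and the sign of one
  -- derivative does not decide. Grönwall does: `(ρ ∘ γ)' ≥ K (ρ ∘ γ)` makes this product
  -- nondecreasing, and it vanishes at `t₀`, against `ρ ∘ γ < 0` afterwards.
  have hder : ∀ t ∈ Icc t₀ t₂, HasDerivAt (fun t => ρ (γ t) * Real.exp (-K * t))
      (fderiv ℝ ρ (γ t) (dilGen α (γ t)) * Real.exp (-K * t) +
        ρ (γ t) * (Real.exp (-K * t) * (-K * 1))) t := by
    intro t ht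
    have h1 : DifferentiableAt ℝ ρ (γ t) := (hρ.smooth.contDiffAt
      (hρ.isOpen.mem_nhds (hball t (hball' t ht)).2)).differentiableAt (by simp)
    exact (h1.hasFDerivAt.comp_hasDerivAt t (hγd t)).mul (((hasDerivAt_id t).const_mul (-K)).exp)
  have hmono : MonotoneOn (fun t => ρ (γ t) * Real.exp (-K * t)) (Icc t₀ t₂) := by
    refine monotoneOn_of_deriv_nonneg (convex_Icc _ _)
      (fun t ht => (hder t ht).continuousAt.continuousWithinAt)
      (fun t ht => (hder t (interior_subset ht)).differentiableAt.differentiableWithinAt) ?_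
    intro t ht
    rw [(hder t (interior_subset ht)).deriv]
    rw [interior_Icc] at ht
    have h1 := (hball t (hball' t (Ioo_subset_Icc_self ht))).1
      (hneg t (Ioo_subset_Ioc_self ht))
    have h2 := mul_nonneg (sub_nonneg.2 h1) (Real.exp_pos (-K * t)).le
    linarith
  have hlast := hmono (left_mem_Icc.2 ht₂.le) (right_mem_Icc.2 ht₂.le) ht₂.le
  simp only [hρ.eq_zero_of_mem_frontier hfr, zero_mul] at hlast
  exact absurd (nonneg_of_mul_nonneg_left hlast (Real.exp_pos _))
    (not_le.2 (hneg t₂ (right_mem_Ioc.2 ht₂)))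

/-! ### Truncation, zero sets and integration along a direction -/

/-- Smooth truncations: the `η n` vanish near `0`, have uniformly bounded derivatives and
converge to the identity. -/
theorem exists_smooth_truncation : ∃ (η : ℕ → ℝ → ℝ) (C : ℝ), 0 ≤ C ∧ (∀ n, ContDiff ℝ 1 (η n)) ∧
    (∀ n, ∃ ε > 0, ∀ s, |s| < ε → η n s = 0) ∧ (∀ n s, |deriv (η n) s| ≤ C) ∧
    (∀ n s, |η n s| ≤ |s|) ∧ (∀ s, Tendsto (fun n => η n s) atTop (𝓝 s)) ∧
    ∀ s, s ≠ 0 → Tendsto (fun n => deriv (η n) s) atTop (𝓝 1) := by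
  let b : ContDiffBump (0 : ℝ) := ⟨1, 2, one_pos, one_lt_two⟩
  -- Zero for `|t| ≤ 1` and the identity for `|t| ≥ 2`. The rescaling `g ((n + 1) s) / (n + 1)`
  -- shrinks the transition zone and leaves the bound on the derivative unchanged.
  let g : ℝ → ℝ := fun t => t * (1 - b t)
  have hb : ContDiff ℝ 1 b := b.contDiff
  have hg : ContDiff ℝ 1 g := contDiff_id.mul (contDiff_const.sub hb)
  have hg0 : ∀ t, |t| < 1 → g t = 0 := by
    intro t ht
    have : b t = 1 := b.one_of_mem_closedBall (by simpa using ht.le)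
    simp [g, this]
  have hg1 : ∀ t, 2 < |t| → g t = t := by
    intro t ht
    have : b t = 0 := b.zero_of_le_dist (by simpa using ht.le)
    simp [g, this]
  have hgle : ∀ t, |g t| ≤ |t| := by
    intro t
    have h0 := b.nonneg (x := t)
    have h1 := b.le_one (x := t)
    rw [abs_mul, abs_of_nonneg (by linarith : 0 ≤ 1 - b t)]
    exact mul_le_of_le_one_right (abs_nonneg _) (by linarith)
  obtain ⟨C, hC⟩ : ∃ C, ∀ t, |deriv g t| ≤ C := by
    have hcs : HasCompactSupport (fun t => t * b t) := b.hasCompactSupport.mul_left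
    have hsm : ContDiff ℝ 1 (fun t => t * b t) := contDiff_id.mul hb
    obtain ⟨C, hC⟩ := hcs.deriv.exists_bound_of_continuous (hsm.continuous_deriv le_rfl)
    refine ⟨1 + C, fun t => ?_⟩
    have h1 : HasDerivAt g (1 - deriv (fun t => t * b t) t) t := by
      have h2 := (hasDerivAt_id t).sub ((hsm.differentiable one_ne_zero) t).hasDerivAt
      refine h2.congr_of_eventuallyEq (Eventually.of_forall fun s => ?_)
      simp [g]
      ring
    rw [h1.deriv]
    have h3 := hC t
    rw [Real.norm_eq_abs] at h3
    calc _ ≤ |(1 : ℝ)| + |deriv (fun t => t * b t) t| := abs_sub _ _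
      _ ≤ _ := by rw [abs_one]; linarith
  have hder : ∀ (n : ℕ) (s : ℝ), HasDerivAt (fun s : ℝ => g ((n + 1) * s) / (n + 1))
      (deriv g ((n + 1) * s)) s := by
    intro n s
    have h1 : HasDerivAt (fun s : ℝ => ((n : ℝ) + 1) * s) (n + 1) s := by
      simpa using (hasDerivAt_id s).const_mul ((n : ℝ) + 1)
    have h2 := (((hg.differentiable one_ne_zero) ((n + 1) * s)).hasDerivAt.comp s h1).div_const
      ((n : ℝ) + 1)
    refine h2.congr_deriv ?_
    field_simp
  have hlarge : ∀ s : ℝ, s ≠ 0 → ∀ᶠ n : ℕ in atTop, 2 < |((n : ℝ) + 1) * s| := by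
    intro s hs
    have : Tendsto (fun n : ℕ => ((n : ℝ) + 1) * |s|) atTop atTop :=
      (tendsto_atTop_add_const_right _ _ tendsto_natCast_atTop_atTop).atTop_mul_const
        (abs_pos.2 hs)
    filter_upwards [this.eventually_gt_atTop 2] with n hn
    rwa [abs_mul, abs_of_nonneg (by positivity : (0 : ℝ) ≤ n + 1)]
  refine ⟨fun n s => g ((n + 1) * s) / (n + 1), C, (abs_nonneg _).trans (hC 0), fun n => ?_,
    fun n => ?_, fun n s => ?_, fun n s => ?_, fun s => ?_, fun s hs => ?_⟩
  · exact (hg.comp (contDiff_const.mul contDiff_id)).div_const _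
  · refine ⟨1 / (n + 1), by positivity, fun s hs => ?_⟩
    change g ((n + 1) * s) / (n + 1) = 0
    rw [hg0, zero_div]
    rw [abs_mul, abs_of_nonneg (by positivity : (0 : ℝ) ≤ n + 1)]
    rwa [lt_div_iff₀' (by positivity)] at hs
  · rw [(hder n s).deriv]
    exact hC _
  · have h0 : (0 : ℝ) < n + 1 := by positivity
    rw [abs_div, abs_of_pos h0, div_le_iff₀ h0]
    refine (hgle _).trans ?_
    rw [abs_mul, abs_of_pos h0, mul_comm]
  · rcases eq_or_ne s 0 with rfl | hs
    · simp [g]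
    · refine tendsto_const_nhds.congr' ?_
      filter_upwards [hlarge s hs] with n hn
      rw [hg1 _ hn]
      field_simp
  · refine tendsto_const_nhds.congr' ?_
    filter_upwards [hlarge s hs] with n hn
    rw [(hder n s).deriv]
    have : g =ᶠ[𝓝 (((n : ℝ) + 1) * s)] id := by
      filter_upwards [continuous_abs.continuousAt.eventually (lt_mem_nhds hn)] with t ht
      exact hg1 t ht
    rw [this.deriv_eq, deriv_id]

section

variable {E : Type*} [NormedAddCommGroup E] [NormedSpace ℝ E]

/-- The composition of a function that vanishes near `0` with a continuous function that
vanishes outside `O`, and is of class `C¹` in `O`. -/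
theorem truncation_comp {O : Set E} (hO : IsOpen O) {v : E → ℝ} (hv : Continuous v)
    (hvs : HasCompactSupport v) (hv1 : ContDiffOn ℝ 1 v O) (hv0 : ∀ z ∉ O, v z = 0)
    {η : ℝ → ℝ} (hη : ContDiff ℝ 1 η) {ε : ℝ} (hε : 0 < ε) (hη0 : ∀ s, |s| < ε → η s = 0) :
    ContDiff ℝ 1 (η ∘ v) ∧ HasCompactSupport (η ∘ v) ∧ tsupport (η ∘ v) ⊆ O ∧
      ∀ z e, fderiv ℝ (η ∘ v) z e = deriv η (v z) * O.indicator (fun z => fderiv ℝ v z e) z := by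
  -- The support lies in the closed set `{ε ≤ |v|}`, which avoids the complement of `O` because `v =
  -- 0` there.
  have hts : tsupport (η ∘ v) ⊆ O := by
    have hcl : IsClosed {z | ε ≤ |v z|} := isClosed_le continuous_const hv.abs
    have h1 : tsupport (η ∘ v) ⊆ {z | ε ≤ |v z|} := by
      refine closure_minimal (fun z hz => ?_) hcl
      by_contra h2
      exact hz (hη0 _ (not_le.1 h2))
    intro z hz
    by_contra h2
    have h3 : ε ≤ |v z| := h1 hz
    rw [hv0 z h2, abs_zero] at h3
    linarith
  have hat : ∀ z ∈ O, ContDiffAt ℝ 1 v z := fun z hz => hv1.contDiffAt (hO.mem_nhds hz)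
  refine ⟨contDiff_iff_contDiffAt.2 fun z => ?_, hvs.comp_left (hη0 0 (by simpa using hε)), hts,
    fun z e => ?_⟩
  · by_cases hz : z ∈ O
    · exact hη.contDiffAt.comp z (hat z hz)
    · exact contDiffAt_const.congr_of_eventuallyEq
        (notMem_tsupport_iff_eventuallyEq.1 fun h => hz (hts h))
  · by_cases hz : z ∈ O
    · have h1 := ((hη.differentiable one_ne_zero) (v z)).hasDerivAt.comp_hasFDerivAt z
        ((hat z hz).differentiableAt one_ne_zero).hasFDerivAt
      rw [h1.fderiv, indicator_of_mem hz]
      rfl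
    · rw [indicator_of_notMem hz, mul_zero,
        (notMem_tsupport_iff_eventuallyEq.1 fun h => hz (hts h)).fderiv_eq]
      simp

variable [FiniteDimensional ℝ E] [MeasurableSpace E] [BorelSpace E]

/-- The derivative of a function vanishes almost everywhere on its zero set. -/
theorem ae_fderiv_apply_eq_zero_of_eq_zero (μ : Measure E) [μ.IsAddHaarMeasure] {O : Set E}
    (hO : IsOpen O) {v : E → ℝ} (hv : Continuous v) (hv1 : DifferentiableOn ℝ v O) (e : E) :
    ∀ᵐ z ∂μ, z ∈ O → v z = 0 → fderiv ℝ v z e = 0 := by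
  set S : Set E := {z | z ∈ O → v z = 0 → fderiv ℝ v z e = 0} with hS
  have hSm : MeasurableSet S := by
    have h1 : MeasurableSet {z | v z = 0} := measurableSet_eq_fun hv.measurable measurable_const
    have h2 : MeasurableSet {z | fderiv ℝ v z e = 0} :=
      measurableSet_eq_fun (measurable_fderiv_apply_const ℝ v e) measurable_const
    have : S = Oᶜ ∪ ({z | v z = 0}ᶜ ∪ {z | fderiv ℝ v z e = 0}) := by
      ext z
      simp only [hS, mem_ofPred_eq, mem_union, mem_compl_iff]
      tauto
    rw [this]
    exact hO.measurableSet.compl.union (h1.compl.union h2)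
  let L : ℝ →L[ℝ] E := ContinuousLinearMap.toSpanSingleton ℝ e
  -- Fubini along the lines parallel to `e`: it suffices that each line meets the exceptional set in
  -- a null set.
  refine ae_mem_of_ae_add_linearMap_mem L.toLinearMap volume μ hSm fun y => ?_
  have hcount : {x : ℝ | y + x • e ∉ S}.Countable := by
    set B : Set ℝ := {x : ℝ | y + x • e ∉ S}
    -- At an exceptional point the restriction of `v` to the line has a nonzero derivative, so this
    -- zero is isolated; a discrete subset of the line is countable.
    have hdisc : DiscreteTopology B := by
      rw [discreteTopology_subtype_iff]
      intro x hx
      simp only [B, hS, mem_ofPred_eq, Classical.not_imp] at hx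
      obtain ⟨hxO, hx0, hxd⟩ := hx
      have h1 := ((hv1 _ hxO).differentiableAt (hO.mem_nhds hxO)).hasFDerivAt
      have h2 : HasDerivAt (fun x : ℝ => y + x • e) e x := by
        simpa using ((hasDerivAt_id x).smul_const e).const_add y
      have h3 : HasDerivAt (fun x : ℝ => v (y + x • e)) (fderiv ℝ v (y + x • e) e) x :=
        h1.comp_hasDerivAt x h2
      have h4 := h3.eventually_ne hxd (c := 0)
      rw [← disjoint_iff, disjoint_principal_right]
      filter_upwards [h4] with t ht htB
      simp only [B, hS, mem_ofPred_eq, Classical.not_imp] at htB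
      exact ht htB.2.1
    exact countable_coe_iff.1 (separableSpace_iff_countable.1 inferInstance)
  have := hcount.ae_notMem (volume : Measure ℝ)
  filter_upwards [this] with x hx
  change y + x • e ∈ S
  exact not_not.1 hx

/-- The integral of a directional derivative against a weight that is invariant in that
direction. -/
theorem integral_mul_fderiv_eq_zero (μ : Measure E) [μ.IsAddHaarMeasure] {ψ w : E → ℝ} {e : E}
    (hψ : ContDiff ℝ 1 ψ) (hψs : HasCompactSupport ψ) (hw : Continuous w)
    (hwe : ∀ z (t : ℝ), w (z + t • e) = w z) : ∫ z, w z * fderiv ℝ ψ z e ∂μ = 0 := by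
  obtain ⟨C, hC⟩ := ContDiff.lipschitzWith_of_hasCompactSupport hψs hψ one_ne_zero
  -- Difference quotients of `ψ` spare any derivative of `w`: each has zero integral against `w` by
  -- translation invariance, and so does the limit.
  have h1 := hC.integral_inv_smul_sub_mul_tendsto_integral_lineDeriv_mul' (μ := μ) hψs hw e
  have hint : Integrable (fun z => ψ z * w z) μ :=
    (hψ.continuous.mul hw).integrable_of_hasCompactSupport hψs.mul_right
  have h2 : ∀ t : ℝ, ∫ x, (t⁻¹ • (ψ (x + t • e) - ψ x)) * w x ∂μ = 0 := by
    intro t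
    have h3 : ∀ x, (t⁻¹ • (ψ (x + t • e) - ψ x)) * w x =
        t⁻¹ * (ψ (x + t • e) * w (x + t • e) - ψ x * w x) := by
      intro x
      rw [hwe, smul_eq_mul]
      ring
    simp_rw [h3]
    rw [integral_const_mul, integral_sub (hint.comp_add_right (t • e)) hint,
      integral_add_right_eq_self (fun x => ψ x * w x), sub_self, mul_zero]
  simp_rw [h2] at h1
  have h4 := tendsto_nhds_unique h1 tendsto_const_nhds
  rw [← h4]
  refine integral_congr_ae (Eventually.of_forall fun z => ?_)
  simp only
  rw [((hψ.differentiable one_ne_zero) z).lineDeriv_eq_fderiv, mul_comm]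

end

/-! ### Enlarging the class of test functions -/

theorem continuous_partialDeriv {φ : Space3 → ℝ} (hφ : ContDiff ℝ 1 φ) (i : Fin 3) :
    Continuous (partialDeriv i φ) :=
  (hφ.continuous_fderiv one_ne_zero).clm_apply continuous_const

theorem hasCompactSupport_partialDeriv {φ : Space3 → ℝ} (hφ : HasCompactSupport φ) (i : Fin 3) :
    HasCompactSupport (partialDeriv i φ) :=
  (hφ.fderiv ℝ).comp_left (g := fun A : Space3 →L[ℝ] ℝ => A (EuclideanSpace.single i 1)) (by simp)

/-- Test functions are dense in the compactly supported functions of class `C¹`. -/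
theorem exists_testFunction_approx {Ω : Opens Space3} {φ : Space3 → ℝ} (hφ : ContDiff ℝ 1 φ)
    (hφs : HasCompactSupport φ) (hφΩ : tsupport φ ⊆ Ω) {ε : ℝ} (hε : 0 < ε) :
    ∃ χ : 𝓓(Ω, ℝ), ∀ z, |χ z - φ z| ≤ ε ∧
      ∀ i, |partialDeriv i χ z - partialDeriv i φ z| ≤ ε := by
  obtain ⟨δ₀, hδ₀, hsub⟩ := hφs.isCompact.exists_cthickening_subset_open Ω.isOpen hφΩ
  have huc : ∀ ψ : Space3 → ℝ, Continuous ψ → HasCompactSupport ψ →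
      ∃ δ > 0, ∀ x y, dist x y < δ → dist (ψ x) (ψ y) < ε := fun ψ h1 h2 =>
    Metric.uniformContinuous_iff.1 (h2.uniformContinuous_of_continuous h1) ε hε |>.imp
      fun δ h => ⟨h.1, fun x y hxy => h.2 hxy⟩
  obtain ⟨δ₁, hδ₁, h₁⟩ := huc φ hφ.continuous hφs
  choose δ₂ hδ₂ h₂ using fun i => huc _ (continuous_partialDeriv hφ i)
    (hasCompactSupport_partialDeriv hφs i)
  -- The mollification radius: below `δ₀` the support stays in `Ω`, and below the others the uniform
  -- continuity of `φ` and of its partial derivatives bounds the errors by `ε`.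
  obtain ⟨δ, hδ, hd0, hd1, hd2⟩ : ∃ δ > 0, δ ≤ δ₀ ∧ δ ≤ δ₁ ∧ ∀ i, δ ≤ δ₂ i := by
    refine ⟨min (min δ₀ δ₁) (min (δ₂ 0) (min (δ₂ 1) (δ₂ 2))), by simp [*], ?_, ?_, fun i => ?_⟩
    · simp
    · simp
    · fin_cases i <;> simp
  let ρ : ContDiffBump (0 : Space3) := ⟨δ / 2, δ, half_pos hδ, half_lt_self hδ⟩
  have hloc : LocallyIntegrable (ρ.normed (volume : Measure Space3)) :=
    ρ.continuous_normed.locallyIntegrable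
  let L := ContinuousLinearMap.lsmul ℝ (E := ℝ) ℝ
  set χ : Space3 → ℝ := convolution (ρ.normed volume) φ L volume with hχ
  have hpd : ∀ i z, partialDeriv i χ z =
      convolution (ρ.normed volume) (partialDeriv i φ) L volume z := by
    intro i z
    have h := hφs.hasFDerivAt_convolution_right L hloc hφ z
    unfold partialDeriv
    rw [hχ, h.fderiv, convolution_precompR_apply _ hloc (hφs.fderiv ℝ)
      (hφ.continuous_fderiv one_ne_zero)]
  refine ⟨⟨χ, ?_, ?_, ?_⟩, fun z => ⟨?_, fun i => ?_⟩⟩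
  · exact ρ.hasCompactSupport_normed.contDiff_convolution_left L ρ.contDiff_normed
      hφ.continuous.locallyIntegrable
  · exact ρ.hasCompactSupport_normed.convolution L hφs
  · refine Subset.trans ?_ hsub
    refine closure_minimal ?_ Metric.isClosed_cthickening
    refine (support_convolution_subset L).trans ?_
    rintro _ ⟨a, ha, b, hb, rfl⟩
    rw [ρ.support_normed_eq] at ha
    refine Metric.mem_cthickening_of_dist_le _ b _ _ (subset_tsupport _ hb) ?_
    have : ‖a‖ < δ := by simpa using ha
    simpa [dist_eq_norm] using this.le.trans hd0
  · rw [← Real.dist_eq]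
    exact ρ.dist_normed_convolution_le hφ.continuous.aestronglyMeasurable
      fun x hx => (h₁ x z (lt_of_lt_of_le (Metric.mem_ball.1 hx) hd1)).le
  · rw [← Real.dist_eq]
    change dist (partialDeriv i χ z) _ ≤ ε
    rw [hpd]
    exact ρ.dist_normed_convolution_le (continuous_partialDeriv hφ i).aestronglyMeasurable
      fun x hx => (h₂ i x z (lt_of_lt_of_le (Metric.mem_ball.1 hx) (hd2 i))).le

section Bounded

variable {Ω : Opens Space3} (hΩ : Bornology.IsBounded (Ω : Set Space3))
include hΩ

theorem integrable_indicator_const (C : ℝ) :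
    Integrable ((Ω : Set Space3).indicator fun _ => C) :=
  (integrable_indicator_iff Ω.isOpen.measurableSet).2
    (integrableOn_const hΩ.measure_lt_top.ne)

theorem integrable_of_bounded {f : Space3 → ℝ} {C : ℝ} (hm : Measurable f)
    (hC : ∀ z, |f z| ≤ C) (h0 : ∀ z ∉ Ω, f z = 0) : Integrable f := by
  refine (integrable_indicator_const hΩ C).mono' hm.aestronglyMeasurable
    (Eventually.of_forall fun z => ?_)
  by_cases hz : z ∈ (Ω : Set Space3)
  · rw [indicator_of_mem hz]
    exact hC z
  · rw [indicator_of_notMem hz, h0 z hz, norm_zero]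

theorem tendsto_integral_of_bounded {F : ℕ → Space3 → ℝ} {f : Space3 → ℝ} {C : ℝ}
    (hm : ∀ n, Measurable (F n)) (hC : ∀ n z, |F n z| ≤ C) (h0 : ∀ n, ∀ z ∉ Ω, F n z = 0)
    (hlim : ∀ᵐ z, Tendsto (fun n => F n z) atTop (𝓝 (f z))) :
    Tendsto (fun n => ∫ z, F n z) atTop (𝓝 (∫ z, f z)) := by
  refine tendsto_integral_of_dominated_convergence _ (fun n => (hm n).aestronglyMeasurable)
    (integrable_indicator_const hΩ C) (fun n => Eventually.of_forall fun z => ?_) hlim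
  by_cases hz : z ∈ (Ω : Set Space3)
  · rw [indicator_of_mem hz]
    exact hC n z
  · rw [indicator_of_notMem hz, h0 n z hz, norm_zero]

end Bounded

/-- Provides the dominating constants for the integrands of the weak equations: there are four
products, each at most `K * C`. -/
theorem abs_sum_mul_sub_mul_le {B X : Fin 3 → ℝ} {F Y K C : ℝ} (hB : ∀ i, |B i| ≤ K)
    (hF : |F| ≤ K) (hX : ∀ i, |X i| ≤ C) (hY : |Y| ≤ C) :
    |∑ i, B i * X i - F * Y| ≤ 4 * (K * C) := by
  have hK : 0 ≤ K := (abs_nonneg _).trans hF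
  have h : ∀ a b : ℝ, |a| ≤ K → |b| ≤ C → |a * b| ≤ K * C := fun a b ha hb => by
    rw [abs_mul]
    exact mul_le_mul ha hb (abs_nonneg _) hK
  have h0 := abs_le.1 (h _ _ (hB 0) (hX 0))
  have h1 := abs_le.1 (h _ _ (hB 1) (hX 1))
  have h2 := abs_le.1 (h _ _ (hB 2) (hX 2))
  have h3 := abs_le.1 (h _ _ hF hY)
  rw [Fin.sum_univ_three, abs_le]
  constructor <;> linarith [h0.1, h0.2, h1.1, h1.2, h2.1, h2.2, h3.1, h3.2]

section Weak

variable {Ω : Opens Space3} {B : Fin 3 → Space3 → ℝ} {F : Space3 → ℝ} {K : ℝ}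

/-- A first-order weak equation extends from test functions to `C¹` functions with compact
support. -/
theorem weak_equation_of_contDiff_one (hΩ : Bornology.IsBounded (Ω : Set Space3))
    (hB : ∀ i, Measurable (B i)) (hF : Measurable F) (hBK : ∀ i z, |B i z| ≤ K)
    (hFK : ∀ z, |F z| ≤ K) (hB0 : ∀ i, ∀ z ∉ Ω, B i z = 0) (hF0 : ∀ z ∉ Ω, F z = 0)
    (h : ∀ χ : 𝓓(Ω, ℝ), ∫ z, (∑ i, B i z * partialDeriv i χ z - F z * χ z) = 0)
    {φ : Space3 → ℝ} (hφ : ContDiff ℝ 1 φ) (hφs : HasCompactSupport φ) (hφΩ : tsupport φ ⊆ Ω) :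
    ∫ z, (∑ i, B i z * partialDeriv i φ z - F z * φ z) = 0 := by
  have hε : ∀ n : ℕ, (0 : ℝ) < 1 / ((n : ℝ) + 1) := fun n => by positivity
  have hlim := tendsto_one_div_add_atTop_nhds_zero_nat (𝕜 := ℝ)
  choose χ hχ using fun n : ℕ => exists_testFunction_approx hφ hφs hφΩ (hε n)
  obtain ⟨C, hC⟩ := hφs.exists_bound_of_continuous hφ.continuous
  choose C' hC' using fun i => (hasCompactSupport_partialDeriv hφs i).exists_bound_of_continuous
    (continuous_partialDeriv hφ i)
  have hε1 : ∀ n : ℕ, 1 / ((n : ℝ) + 1) ≤ 1 := fun n => by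
    rw [div_le_one (by positivity)]
    linarith [(Nat.cast_nonneg n : (0 : ℝ) ≤ n)]
  obtain ⟨M, hM, hM'⟩ : ∃ M, (∀ n z, |χ n z| ≤ M) ∧ ∀ i n z, |partialDeriv i (χ n) z| ≤ M := by
    refine ⟨1 + (|C| + |C' 0| + |C' 1| + |C' 2|), fun n z => ?_, fun i n z => ?_⟩
    · have h1 := abs_sub_abs_le_abs_sub (χ n z) (φ z)
      have h2 := (hC z).trans (le_abs_self C)
      rw [Real.norm_eq_abs] at h2
      linarith [(hχ n z).1, hε1 n, abs_nonneg (C' 0), abs_nonneg (C' 1), abs_nonneg (C' 2)]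
    · have h1 := abs_sub_abs_le_abs_sub (partialDeriv i (χ n) z) (partialDeriv i φ z)
      have h2 := (hC' i z).trans (le_abs_self _)
      rw [Real.norm_eq_abs] at h2
      have h3 : |C' i| ≤ |C' 0| + |C' 1| + |C' 2| := by
        rw [← Fin.sum_univ_three fun i => |C' i|]
        exact Finset.single_le_sum (f := fun i => |C' i|) (fun _ _ => abs_nonneg _)
          (Finset.mem_univ i)
      linarith [(hχ n z).2 i, hε1 n, abs_nonneg C]
  have hto : ∀ (a : ℕ → ℝ) (b : ℝ), (∀ n : ℕ, |a n - b| ≤ 1 / ((n : ℝ) + 1)) →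
      Tendsto a atTop (𝓝 b) := fun a b hab => by
    rw [tendsto_iff_dist_tendsto_zero]
    exact squeeze_zero (fun _ => dist_nonneg) (fun n => (Real.dist_eq _ _).trans_le (hab n)) hlim
  have hχ1 : ∀ n, ContDiff ℝ 1 (χ n) := fun n => (χ n).contDiff.of_le (by simp)
  have := tendsto_integral_of_bounded hΩ
    (F := fun n z => ∑ i, B i z * partialDeriv i (χ n) z - F z * χ n z)
    (f := fun z => ∑ i, B i z * partialDeriv i φ z - F z * φ z) (C := 4 * (K * M))
    (fun n => (Finset.measurable_sum _ fun i _ =>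
      (hB i).mul (continuous_partialDeriv (hχ1 n) i).measurable).sub
        (hF.mul (χ n).continuous.measurable))
    (fun n z => abs_sum_mul_sub_mul_le (fun i => hBK i z) (hFK z) (fun i => hM' i n z) (hM n z))
    (fun n z hz => by simp [hB0 _ z hz, hF0 z hz])
    (Eventually.of_forall fun z => by
      refine (tendsto_finsetSum _ fun i _ => ?_).sub ?_
      · exact (hto _ _ fun n => (hχ n z).2 i).const_mul _
      · exact (hto _ _ fun n => (hχ n z).1).const_mul _)
  simp_rw [h] at this
  exact (tendsto_nhds_unique tendsto_const_nhds this).symm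

/-- A first-order weak equation may be tested with a continuous function that vanishes outside an
open subset `O` of `Ω`, and has bounded continuous derivatives in `O`. -/
theorem weak_equation_of_eq_zero (hΩ : Bornology.IsBounded (Ω : Set Space3))
    (hB : ∀ i, Measurable (B i)) (hF : Measurable F) (hBK : ∀ i z, |B i z| ≤ K)
    (hFK : ∀ z, |F z| ≤ K) (hB0 : ∀ i, ∀ z ∉ Ω, B i z = 0) (hF0 : ∀ z ∉ Ω, F z = 0)
    (h : ∀ χ : 𝓓(Ω, ℝ), ∫ z, (∑ i, B i z * partialDeriv i χ z - F z * χ z) = 0)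
    {O : Set Space3} (hO : IsOpen O) (hOΩ : O ⊆ Ω) {v : Space3 → ℝ} (hv : Continuous v)
    (hvs : HasCompactSupport v) (hv1 : ContDiffOn ℝ 1 v O) (hv0 : ∀ z ∉ O, v z = 0) {C : ℝ}
    (hC : ∀ i z, |O.indicator (partialDeriv i v) z| ≤ C) :
    ∫ z, (∑ i, B i z * O.indicator (partialDeriv i v) z - F z * v z) = 0 := by
  obtain ⟨η, M, hM0, hη1, hη0, hηM, hηle, hηlim, hηlim'⟩ := exists_smooth_truncation
  obtain ⟨C₁, hC₁⟩ := hvs.exists_bound_of_continuous hv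
  choose ε hε hηε using hη0
  choose h1 h2 h3 h4 using fun n => truncation_comp hO hv hvs hv1 hv0 (hη1 n) (hε n) (hηε n)
  have h4' : ∀ n i z, partialDeriv i (η n ∘ v) z =
      deriv (η n) (v z) * O.indicator (partialDeriv i v) z := fun n i z => h4 n z _
  have hw := fun n => weak_equation_of_contDiff_one hΩ hB hF hBK hFK hB0 hF0 h (h1 n) (h2 n)
    ((h3 n).trans hOΩ)
  -- The derivatives of the truncations tend to `1` only away from `0`, so the limit on `{v = 0}` is
  -- correct only because the gradient vanishes almost everywhere there.
  have hae : ∀ᵐ z, ∀ i, z ∈ O → v z = 0 → partialDeriv i v z = 0 := by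
    rw [ae_all_iff]
    exact fun i => ae_fderiv_apply_eq_zero_of_eq_zero volume hO hv (hv1.differentiableOn_one) _
  have hKC : 0 ≤ C := (abs_nonneg _).trans (hC 0 0)
  have := tendsto_integral_of_bounded hΩ
    (F := fun n z => ∑ i, B i z * partialDeriv i (η n ∘ v) z - F z * (η n ∘ v) z)
    (f := fun z => ∑ i, B i z * O.indicator (partialDeriv i v) z - F z * v z)
    (C := 4 * (K * (M * C + |C₁|)))
    (fun n => (Finset.measurable_sum _ fun i _ =>
      (hB i).mul (continuous_partialDeriv (h1 n) i).measurable).sub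
        (hF.mul (h1 n).continuous.measurable))
    (fun n z => abs_sum_mul_sub_mul_le (fun i => hBK i z) (hFK z)
      (fun i => by
        rw [h4', abs_mul]
        exact (mul_le_mul (hηM _ _) (hC i z) (abs_nonneg _) hM0).trans
          (le_add_of_nonneg_right (abs_nonneg _)))
      (((hηle n _).trans ((hC₁ z).trans (le_abs_self _))).trans
        (le_add_of_nonneg_left (mul_nonneg hM0 hKC))))
    (fun n z hz => by simp [hB0 _ z hz, hF0 z hz])
    (by
      filter_upwards [hae] with z hz
      refine (tendsto_finsetSum _ fun i _ => ?_).sub ((hηlim _).const_mul _)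
      refine Tendsto.const_mul _ ?_
      simp_rw [h4']
      by_cases hzO : z ∈ O
      · rw [indicator_of_mem hzO]
        by_cases hvz : v z = 0
        · rw [hz i hzO hvz]
          simp
        · simpa using (hηlim' _ hvz).mul_const (partialDeriv i v z)
      · rw [indicator_of_notMem hzO]
        simp)
  simp_rw [hw] at this
  exact (tendsto_nhds_unique tendsto_const_nhds this).symm

end Weak

/-! ### Extension by zero -/

/-- A continuous function that vanishes outside an open set, with bounded derivative in it, is
Lipschitz. -/
theorem exists_lipschitzWith_of_eq_zero {E : Type*} [NormedAddCommGroup E] [NormedSpace ℝ E]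
    {O : Set E} (hO : IsOpen O) {v : E → ℝ}
    (hv : Continuous v) (hvs : HasCompactSupport v) (hv1 : ContDiffOn ℝ 1 v O)
    (hv0 : ∀ z ∉ O, v z = 0) {C : ℝ} (hC : ∀ z ∈ O, ‖fderiv ℝ v z‖ ≤ C) :
    ∃ L : NNReal, LipschitzWith L v := by
  obtain ⟨η, M, hM0, hη1, hη0, hηM, -, hηlim, -⟩ := exists_smooth_truncation
  refine ⟨Real.toNNReal (M * |C|), LipschitzWith.of_dist_le_mul fun x y => ?_⟩
  choose ε hε hηε using hη0
  choose h1 h2 h3 h4 using fun n => truncation_comp hO hv hvs hv1 hv0 (hη1 n) (hε n) (hηε n)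
  -- `O` need not be convex, so the mean value inequality is applied to the truncations, which are
  -- `C¹` on the whole space; their common constant passes to the limit.
  have hlip : ∀ n, LipschitzWith (Real.toNNReal (M * |C|)) (η n ∘ v) := fun n => by
    refine lipschitzWith_of_nnnorm_fderiv_le ((h1 n).differentiable one_ne_zero) fun z => ?_
    rw [← NNReal.coe_le_coe, coe_nnnorm, Real.coe_toNNReal _ (mul_nonneg hM0 (abs_nonneg _))]
    refine ContinuousLinearMap.opNorm_le_bound _ (mul_nonneg hM0 (abs_nonneg _)) fun e => ?_
    rw [h4, norm_mul, mul_assoc]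
    refine mul_le_mul (hηM _ _) ?_ (norm_nonneg _) hM0
    by_cases hz : z ∈ O
    · rw [indicator_of_mem hz]
      refine (ContinuousLinearMap.le_opNorm _ _).trans ?_
      gcongr
      exact (hC z hz).trans (le_abs_self _)
    · rw [indicator_of_notMem hz, norm_zero]
      positivity
  exact le_of_tendsto ((hηlim (v x)).dist (hηlim (v y)))
    (Eventually.of_forall fun n => (hlip n).dist_le_mul x y)

/-- `v` vanishes outside `Ω`, is continuous, and is of class `C¹` in `Ω` with bounded partial
derivatives. -/
structure IsC10Extension (Ω : Opens Space3) (v : Space3 → ℝ) : Prop where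
  continuous : Continuous v
  contDiffOn : ContDiffOn ℝ 1 v Ω
  eq_zero : ∀ z ∉ Ω, v z = 0
  exists_bound : ∃ C, ∀ i z, |(Ω : Set Space3).indicator (partialDeriv i v) z| ≤ C

theorem MemC10.isC10Extension_indicator {Ω : Opens Space3} {u : Space3 → ℝ}
    (hΩ : Bornology.IsBounded (Ω : Set Space3)) (hu : MemC10 Ω u) :
    IsC10Extension Ω ((Ω : Set Space3).indicator u) where
  continuous := continuous_indicator hu.eq_zero_of_mem_frontier hu.continuousOn
  contDiffOn := hu.contDiffOn.congr fun z hz => indicator_of_mem hz u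
  eq_zero z hz := indicator_of_notMem hz u
  exists_bound := by
    choose G hG hGu using hu.partialDeriv_extends
    choose C hC using fun i => hΩ.isCompact_closure.exists_bound_of_continuousOn (hG i)
    refine ⟨∑ i, |C i|, fun i z => ?_⟩
    by_cases hz : z ∈ (Ω : Set Space3)
    · have h1 : partialDeriv i ((Ω : Set Space3).indicator u) z = partialDeriv i u z := by
        have : (Ω : Set Space3).indicator u =ᶠ[𝓝 z] u := by
          filter_upwards [Ω.isOpen.mem_nhds hz] with w hw using indicator_of_mem hw u
        unfold partialDeriv
        rw [this.fderiv_eq]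
      rw [indicator_of_mem hz, h1, ← hGu i hz, ← Real.norm_eq_abs]
      exact ((hC i z (subset_closure hz)).trans (le_abs_self _)).trans
        (Finset.single_le_sum (f := fun i => |C i|) (fun _ _ => abs_nonneg _) (Finset.mem_univ i))
    · rw [indicator_of_notMem hz, abs_zero]
      exact Finset.sum_nonneg fun _ _ => abs_nonneg _

theorem hasCompactSupport_of_eq_zero {Ω : Opens Space3} {v : Space3 → ℝ}
    (hΩ : Bornology.IsBounded (Ω : Set Space3)) (hv : ∀ z ∉ Ω, v z = 0) :
    HasCompactSupport v :=
  HasCompactSupport.intro hΩ.isCompact_closure fun z hz => hv z fun h => hz (subset_closure h)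

theorem norm_fderiv_le_of_partialDeriv {v : Space3 → ℝ} {z : Space3} {C : ℝ}
    (h : ∀ i, |partialDeriv i v z| ≤ C) : ‖fderiv ℝ v z‖ ≤ 3 * C := by
  have hC : 0 ≤ C := (abs_nonneg _).trans (h 0)
  refine ContinuousLinearMap.opNorm_le_bound _ (by positivity) fun e => ?_
  have he : e = ∑ i, e i • EuclideanSpace.single i (1 : ℝ) := by
    ext j
    simp [Finset.sum_apply, Pi.single_apply]
  have h1 : fderiv ℝ v z e = ∑ i, e i * partialDeriv i v z := by
    conv_lhs => rw [he]
    simp [map_sum, partialDeriv]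
  rw [h1]
  refine (norm_sum_le _ _).trans ?_
  have h2 : ∀ i ∈ Finset.univ, ‖e i * partialDeriv i v z‖ ≤ ‖e‖ * C := fun i _ => by
    rw [norm_mul]
    exact mul_le_mul (PiLp.norm_apply_le e i) (h i) (norm_nonneg _) (norm_nonneg _)
  refine (Finset.sum_le_sum h2).trans_eq ?_
  simp
  ring

theorem IsC10Extension.exists_lipschitzWith {Ω : Opens Space3} {v : Space3 → ℝ}
    (hΩ : Bornology.IsBounded (Ω : Set Space3)) (hv : IsC10Extension Ω v) :
    ∃ L : NNReal, LipschitzWith L v := by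
  obtain ⟨C, hC⟩ := hv.exists_bound
  refine exists_lipschitzWith_of_eq_zero Ω.isOpen hv.continuous
    (hasCompactSupport_of_eq_zero hΩ hv.eq_zero) hv.contDiffOn hv.eq_zero (C := 3 * C)
    fun z hz => norm_fderiv_le_of_partialDeriv fun i => ?_
  have := hC i z
  rwa [indicator_of_mem hz] at this

/-- Integration by parts against a test function, for a weight that does not depend on the
coordinate. -/
theorem IsC10Extension.integral_mul_partialDeriv {Ω : Opens Space3} {v w : Space3 → ℝ}
    (hv : IsC10Extension Ω v) (hw : Continuous w) {i : Fin 3}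
    (hwi : ∀ z (t : ℝ), w (z + t • EuclideanSpace.single i (1 : ℝ)) = w z) (φ : 𝓓(Ω, ℝ)) :
    Integrable (fun z => w z * (Ω : Set Space3).indicator (partialDeriv i v) z *
        partialDeriv i φ z) ∧
      ∫ z, w z * (Ω : Set Space3).indicator (partialDeriv i v) z * partialDeriv i φ z =
        -∫ z, w z * v z * partialDeriv i (partialDeriv i φ) z := by
  set D := (Ω : Set Space3).indicator (partialDeriv i v)
  have hφ2 : ContDiff ℝ 2 φ := φ.contDiff.of_le
    (WithTop.coe_le_coe.2 (le_top : (2 : ℕ∞) ≤ ⊤))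
  have hφ1 : ContDiff ℝ 1 (partialDeriv i φ) :=
    (hφ2.fderiv_right (m := 1) (by norm_num)).clm_apply contDiff_const
  have hφc : HasCompactSupport (partialDeriv i φ) :=
    hasCompactSupport_partialDeriv φ.hasCompactSupport i
  -- The support of `φ` in `Ω` makes this product `C¹` on the whole space; the formula is the
  -- product rule for `ψ` together with the vanishing of the integral of `w * ∂ᵢψ`.
  set ψ : Space3 → ℝ := fun z => v z * partialDeriv i φ z with hψ
  have hψs : HasCompactSupport ψ := hφc.mul_left
  have hat : ∀ z ∈ Ω, ContDiffAt ℝ 1 v z := fun z hz =>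
    hv.contDiffOn.contDiffAt (Ω.isOpen.mem_nhds hz)
  have hout : ∀ z ∉ Ω, ψ =ᶠ[𝓝 z] fun _ => 0 := by
    intro z hz
    have h1 := notMem_tsupport_iff_eventuallyEq.1 fun h => hz (φ.tsupport_subset h)
    filter_upwards [h1.fderiv (𝕜 := ℝ)] with w hw
    simp [hψ, partialDeriv, hw]
  have hψ1 : ContDiff ℝ 1 ψ := contDiff_iff_contDiffAt.2 fun z => by
    by_cases hz : z ∈ Ω
    · exact (hat z hz).mul hφ1.contDiffAt
    · exact contDiffAt_const.congr_of_eventuallyEq (hout z hz)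
  have hder : ∀ z, fderiv ℝ ψ z (EuclideanSpace.single i 1) =
      D z * partialDeriv i φ z + v z * partialDeriv i (partialDeriv i φ) z := by
    intro z
    by_cases hz : z ∈ Ω
    · have h1 := ((hat z hz).differentiableAt one_ne_zero).hasFDerivAt.mul
        ((hφ1.differentiable one_ne_zero) z).hasFDerivAt
      have h3 : fderiv ℝ ψ z = _ := h1.fderiv
      rw [h3]
      have h2 : D z = partialDeriv i v z := indicator_of_mem hz _
      rw [h2]
      simp [partialDeriv]
      ring
    · have h2 : D z = 0 := indicator_of_notMem hz _
      rw [(hout z hz).fderiv_eq, hv.eq_zero z hz, h2]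
      simp
  have hint1 : Integrable (fun z => w z * fderiv ℝ ψ z (EuclideanSpace.single i 1)) :=
    (hw.mul (continuous_partialDeriv hψ1 i)).integrable_of_hasCompactSupport
      (hasCompactSupport_partialDeriv hψs i).mul_left
  have hint2 : Integrable (fun z => w z * v z * partialDeriv i (partialDeriv i φ) z) :=
    ((hw.mul hv.continuous).mul (continuous_partialDeriv hφ1 i)).integrable_of_hasCompactSupport
      (hasCompactSupport_partialDeriv hφc i).mul_left
  have hfun : (fun z => w z * D z * partialDeriv i φ z) = fun z =>
      w z * fderiv ℝ ψ z (EuclideanSpace.single i 1) -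
        w z * v z * partialDeriv i (partialDeriv i φ) z := by
    ext z
    rw [hder]
    ring
  rw [hfun]
  refine ⟨hint1.sub hint2, ?_⟩
  rw [integral_sub hint1 hint2, integral_mul_fderiv_eq_zero volume hψ1 hψs hw hwi, zero_sub]

/-! ### Weights and volume under dilations -/

/-- The weights `1, 1, |x|^{2α}` of the three second derivatives. -/
noncomputable def coordWeight (α : ℝ) : Fin 3 → Space3 → ℝ := ![fun _ => 1, fun _ => 1, weight α]

theorem continuous_weight {α : ℝ} (hα : 0 < α) : Continuous (weight α) := by
  unfold weight horizontalNorm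
  exact Continuous.rpow_const (by fun_prop) fun _ => Or.inr (by positivity)

theorem weight_nonneg (α : ℝ) (z : Space3) : 0 ≤ weight α z :=
  Real.rpow_nonneg (Real.sqrt_nonneg _) _

theorem continuous_coordWeight {α : ℝ} (hα : 0 < α) (i : Fin 3) :
    Continuous (coordWeight α i) := by
  fin_cases i
  · exact continuous_const
  · exact continuous_const
  · exact continuous_weight hα

theorem coordWeight_nonneg (α : ℝ) (i : Fin 3) (z : Space3) : 0 ≤ coordWeight α i z := by
  fin_cases i
  · exact zero_le_one
  · exact zero_le_one
  · exact weight_nonneg α z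

/-- This invariance lets each term be integrated by parts without differentiating `|x|^{2α}`, which
need not be smooth on the axis `x = 0`. -/
theorem coordWeight_add_smul_single (α : ℝ) (i : Fin 3) (z : Space3) (t : ℝ) :
    coordWeight α i (z + t • EuclideanSpace.single i (1 : ℝ)) = coordWeight α i z := by
  fin_cases i
  · rfl
  · rfl
  · simp [coordWeight, weight, horizontalNorm]

theorem horizontalNorm_dil (α : ℝ) {s : ℝ} (hs : 0 ≤ s) (z : Space3) :
    horizontalNorm (dil α s z) = s * horizontalNorm z := by
  have : (s * z 0) ^ 2 + (s * z 1) ^ 2 = s ^ 2 * (z 0 ^ 2 + z 1 ^ 2) := by ring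
  simp [horizontalNorm, dil, dilFactor, this, Real.sqrt_mul (sq_nonneg s), Real.sqrt_sq hs]

theorem weight_dil (α : ℝ) {s : ℝ} (hs : 0 ≤ s) (z : Space3) :
    weight α (dil α s z) = s ^ (2 * α) * weight α z := by
  have h : 0 ≤ horizontalNorm z := Real.sqrt_nonneg _
  rw [weight, horizontalNorm_dil α hs, Real.mul_rpow hs h, weight]

/-- The reason for the exponent `1 + α` in the dilation: all three terms of the energy density scale
by the same factor `s ^ 2`. -/
theorem coordWeight_mul_dilFactor_sq (α : ℝ) {s : ℝ} (hs : 0 < s) (i : Fin 3) (z : Space3) :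
    coordWeight α i z * dilFactor α s i ^ 2 = s ^ 2 * coordWeight α i (dil α s z) := by
  fin_cases i
  · simp [coordWeight, dilFactor]
  · simp [coordWeight, dilFactor]
  · have h1 : (s ^ (1 + α)) ^ 2 = s ^ 2 * s ^ (2 * α) := by
      rw [← Real.rpow_natCast, ← Real.rpow_mul hs.le, ← Real.rpow_natCast, ← Real.rpow_add hs]
      congr 1
      push_cast
      ring
    simp only [coordWeight, dilFactor]
    change weight α z * (s ^ (1 + α)) ^ 2 = s ^ 2 * weight α (dil α s z)
    rw [weight_dil α hs.le, h1]
    ring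

/-- The exponent `1 + 1 + (1 + α)` is the homogeneous dimension of the dilations. -/
theorem det_dil (α : ℝ) {s : ℝ} (hs : 0 < s) :
    LinearMap.det (dil α s : Space3 →ₗ[ℝ] Space3) = s ^ (3 + α) := by
  have h1 : (dil α s : Space3 →ₗ[ℝ] Space3) =
      Matrix.toLpLin 2 2 (Matrix.diagonal (dilFactor α s)) := by
    rw [dil, diagMap, Matrix.coe_toEuclideanCLM_eq_toEuclideanLin]
  rw [h1, LinearMap.det_toLpLin, Matrix.det_diagonal, Fin.prod_univ_three]
  simp only [dilFactor]
  change s * s * s ^ (1 + α) = _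
  rw [show (3 : ℝ) + α = 2 + (1 + α) by ring, Real.rpow_add hs 2, Real.rpow_two]
  ring

theorem integral_comp_dil (α : ℝ) {s : ℝ} (hs : 0 < s) {h : Space3 → ℝ} (hm : Measurable h) :
    ∫ z, h (dil α s z) = s ^ (-(3 + α)) * ∫ z, h z := by
  have hdet := det_dil α hs
  have hpos : 0 < s ^ (3 + α) := Real.rpow_pos_of_pos hs _
  have h1 := Measure.map_linearMap_addHaar_eq_smul_addHaar (volume : Measure Space3)
    (f := (dil α s : Space3 →ₗ[ℝ] Space3)) (by rw [hdet]; exact hpos.ne')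
  rw [hdet, abs_of_pos (inv_pos.2 hpos)] at h1
  have h2 : ∫ z, h (dil α s z) =
      ∫ z, h z ∂(Measure.map (dil α s : Space3 →ₗ[ℝ] Space3) volume) :=
    (integral_map (dil α s).continuous.measurable.aemeasurable hm.aestronglyMeasurable).symm
  rw [h2, h1, integral_smul_measure, ENNReal.toReal_ofReal (inv_pos.2 hpos).le,
    Real.rpow_neg hs.le, smul_eq_mul]

/-! ### First-order expansion of the power -/

/-- A quantitative form of `(|a|^(p+1) - |b|^(p+1)) / (p + 1) ≈ |a|^(p-1) a (a - b)`. -/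
theorem exists_abs_rpow_mul_sub_le {p : ℝ} (hp : 2 < p) (R : ℝ) : ∃ K : ℝ, 0 ≤ K ∧
    ∀ a b : ℝ, |a| ≤ R → |b| ≤ R → |a| ^ (p - 1) * a * (a - b) ≤
      (|a| ^ (p + 1) - |b| ^ (p + 1)) / (p + 1) + K * (a - b) ^ 2 := by
  have hf : ContDiff ℝ 1 (fun t : ℝ => |t| ^ (p - 1) * t) := by
    have h1 : ContDiff ℝ 1 (fun t : ℝ => ‖t‖ ^ (p - 1)) := contDiff_norm_rpow (by linarith)
    exact h1.mul contDiff_id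
  -- `K` is a Lipschitz constant of `|t| ^ (p - 1) * t` on `[-R, R]`. The mean value theorem gives
  -- the difference of the powers exactly at some `ξ` between `b` and `a`; replacing `ξ` by `a`
  -- costs at most `K * (a - b) ^ 2`.
  obtain ⟨K, hK⟩ := hf.contDiffOn.exists_lipschitzOnWith one_ne_zero (convex_Icc (-R) R)
    isCompact_Icc
  have hd : ∀ t : ℝ, HasDerivAt (fun t : ℝ => |t| ^ (p + 1) / (p + 1)) (|t| ^ (p - 1) * t) t := by
    intro t
    have h1 := (hasDerivAt_abs_rpow t (p := p + 1) (by linarith)).div_const (p + 1)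
    refine h1.congr_deriv ?_
    have : p + 1 ≠ 0 := by linarith
    field_simp
    rw [show p + 1 - 2 = p - 1 by ring, mul_comm]
  refine ⟨K, K.2, fun a b ha hb => ?_⟩
  have hseg : ∀ t : ℝ, HasDerivAt (fun t : ℝ => |b + t * (a - b)| ^ (p + 1) / (p + 1))
      (|b + t * (a - b)| ^ (p - 1) * (b + t * (a - b)) * (a - b)) t := fun t => by
    have h1 : HasDerivAt (fun t : ℝ => b + t * (a - b)) (a - b) t := by
      simpa using ((hasDerivAt_id t).mul_const (a - b)).const_add b
    exact (hd (b + t * (a - b))).comp t h1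
  obtain ⟨c, hc, hc'⟩ := exists_hasDerivAt_eq_slope _ _ one_pos
    (fun t _ => (hseg t).continuousAt.continuousWithinAt) (fun t _ => hseg t)
  simp only [one_mul, zero_mul, add_zero, sub_zero, div_one, add_sub_cancel] at hc'
  set ξ := b + c * (a - b) with hξ
  have hξR : ξ ∈ Icc (-R) R := by
    have h1 := abs_le.1 ha
    have h2 := abs_le.1 hb
    have h3 : ξ = (1 - c) * b + c * a := by rw [hξ]; ring
    rw [h3]
    constructor <;> nlinarith [hc.1, hc.2, h1.1, h1.2, h2.1, h2.2]
  have hlip := hK.dist_le_mul a (abs_le.1 ha) ξ hξR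
  simp only [Real.dist_eq] at hlip
  have haξ : |a - ξ| ≤ |a - b| := by
    rw [show a - ξ = (1 - c) * (a - b) by rw [hξ]; ring, abs_mul]
    exact mul_le_of_le_one_left (abs_nonneg _)
      (abs_le.2 ⟨by linarith [hc.2], by linarith [hc.1]⟩)
  have h4 : (|a| ^ (p - 1) * a - |ξ| ^ (p - 1) * ξ) * (a - b) ≤ K * (a - b) ^ 2 := by
    calc _ ≤ |(|a| ^ (p - 1) * a - |ξ| ^ (p - 1) * ξ)| * |a - b| := by
          rw [← abs_mul]; exact le_abs_self _
      _ ≤ K * |a - b| * |a - b| := by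
          gcongr
          exact hlip.trans (by gcongr)
      _ = K * (a - b) ^ 2 := by rw [mul_assoc, ← sq, sq_abs]
  rw [sub_div, ← hc']
  linarith

/-! ### The weak equation and its dilated test functions -/

/-- The weak form of the equation. -/
theorem IsSolution.weak_equation {α : ℝ} (hα : 0 < α) {Ω : Opens Space3}
    (hΩ : Bornology.IsBounded (Ω : Set Space3)) {f : Space3 → ℝ → ℝ} {u F : Space3 → ℝ}
    (hu : IsC10Extension Ω ((Ω : Set Space3).indicator u)) (hsol : IsSolution α Ω f u)
    (hF : ∀ z ∈ Ω, F z = f z (u z)) (φ : 𝓓(Ω, ℝ)) :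
    ∫ z, (∑ i, coordWeight α i z *
      (Ω : Set Space3).indicator (partialDeriv i ((Ω : Set Space3).indicator u)) z *
        partialDeriv i φ z - F z * φ z) = 0 := by
  obtain ⟨⟨g₁, g₂, g₃, hg, heq⟩, -⟩ := hsol
  set v := (Ω : Set Space3).indicator u
  have hint : ∀ g : Space3 → ℝ, ContinuousOn g (closure (Ω : Set Space3)) →
      IntegrableOn (fun z => g z * φ z) Ω := fun g hg =>
    ((hg.mul φ.continuous.continuousOn).integrableOn_compact hΩ.isCompact_closure).mono_set
      subset_closure
  have hφ0 : ∀ z ∉ (Ω : Set Space3), φ z = 0 := fun z hz =>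
    image_eq_zero_of_notMem_tsupport fun h => hz (φ.tsupport_subset h)
  have hibp := fun i => hu.integral_mul_partialDeriv (continuous_coordWeight hα i)
    (coordWeight_add_smul_single α i) φ
  have hD : ∀ i g, IsDistribSecondDeriv Ω i (fun z => coordWeight α i z * u z) g →
      ∫ z, coordWeight α i z * v z * partialDeriv i (partialDeriv i φ) z =
        ∫ z in Ω, g z * φ z := by
    intro i g hig
    rw [← hig φ, ← integral_indicator Ω.isOpen.measurableSet]
    refine integral_congr_ae (Eventually.of_forall fun z => ?_)
    by_cases hz : z ∈ (Ω : Set Space3)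
    · simp [v, hz]
    · simp [v, hz]
  have h0 := hD 0 g₁ (by simpa [coordWeight] using hg.deriv₁)
  have h1 := hD 1 g₂ (by simpa [coordWeight] using hg.deriv₂)
  have h2 := hD 2 g₃ hg.deriv₃
  have hFφ : (fun z => F z * φ z) =
      (Ω : Set Space3).indicator fun z => -(g₁ z * φ z) - g₂ z * φ z - g₃ z * φ z := by
    ext z
    by_cases hz : z ∈ (Ω : Set Space3)
    · rw [indicator_of_mem hz, hF z hz, ← heq z hz]
      ring
    · rw [indicator_of_notMem hz, hφ0 z hz, mul_zero]
  have hi1 := hint g₁ hg.continuousOn₁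
  have hi2 := hint g₂ hg.continuousOn₂
  have hi3 := hint g₃ hg.continuousOn₃
  have hFint : Integrable fun z => F z * φ z := by
    rw [hFφ, integrable_indicator_iff Ω.isOpen.measurableSet]
    exact (hi1.neg.sub hi2).sub hi3
  have hi12 : IntegrableOn (fun z => -(g₁ z * φ z) - g₂ z * φ z) Ω := hi1.neg.sub hi2
  have hi1' : IntegrableOn (fun z => -(g₁ z * φ z)) Ω := hi1.neg
  rw [integral_sub (integrable_finsetSum _ fun i _ => (hibp i).1) hFint,
    integral_finsetSum _ fun i _ => (hibp i).1, Fin.sum_univ_three, (hibp 0).2, (hibp 1).2,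
    (hibp 2).2, h0, h1, h2, hFφ, integral_indicator Ω.isOpen.measurableSet,
    integral_sub hi12 hi3, integral_sub hi1' hi2, integral_neg]
  ring

/-- The chain rule for the dilations. -/
theorem partialDeriv_comp_dil {α s : ℝ} {v : Space3 → ℝ} {z : Space3}
    (hv : DifferentiableAt ℝ v (dil α s z)) (i : Fin 3) :
    partialDeriv i (fun z => v (dil α s z)) z = dilFactor α s i * partialDeriv i v (dil α s z) := by
  have h1 : HasFDerivAt (fun z => v (dil α s z)) _ z :=
    hv.hasFDerivAt.comp z (dil α s).hasFDerivAt
  have h2 : dil α s (EuclideanSpace.single i (1 : ℝ)) =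
      dilFactor α s i • EuclideanSpace.single i (1 : ℝ) := by
    ext j
    by_cases h : j = i
    · subst h
      simp [dil]
    · simp [dil, h]
  unfold partialDeriv
  rw [h1.fderiv, ContinuousLinearMap.comp_apply, h2, map_smul, smul_eq_mul]

/-- A first-order weak equation tested with the composition of `v` with a dilation. -/
theorem IsC10Extension.weak_equation_comp_dil {α : ℝ} {Ω : Opens Space3}
    (hΩ : IsBoundedSmoothDomain Ω) (hstar : IsStarShaped α Ω) {v : Space3 → ℝ}
    (hv : IsC10Extension Ω v) {B : Fin 3 → Space3 → ℝ} {F : Space3 → ℝ} {K : ℝ}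
    (hB : ∀ i, Measurable (B i)) (hF : Measurable F) (hBK : ∀ i z, |B i z| ≤ K)
    (hFK : ∀ z, |F z| ≤ K) (hB0 : ∀ i, ∀ z ∉ Ω, B i z = 0) (hF0 : ∀ z ∉ Ω, F z = 0)
    (h : ∀ χ : 𝓓(Ω, ℝ), ∫ z, (∑ i, B i z * partialDeriv i χ z - F z * χ z) = 0)
    {s : ℝ} (hs : 1 ≤ s) :
    ∫ z, (∑ i, B i z * (dilFactor α s i *
      (Ω : Set Space3).indicator (partialDeriv i v) (dil α s z)) - F z * v (dil α s z)) = 0 := by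
  set O : Set Space3 := dil α s ⁻¹' (Ω : Set Space3) with hO
  have hOo : IsOpen O := Ω.isOpen.preimage (dil α s).continuous
  -- Star-shapedness makes the test admissible: the dilated function vanishes outside `O`, which is
  -- contained in `Ω`.
  have hOΩ : O ⊆ Ω := fun z hz => mem_of_dil_mem hΩ hstar hs hz
  have hv0 : ∀ z ∉ O, v (dil α s z) = 0 := fun z hz => hv.eq_zero _ hz
  have hpd : ∀ i z, O.indicator (partialDeriv i fun z => v (dil α s z)) z = dilFactor α s i *
      (Ω : Set Space3).indicator (partialDeriv i v) (dil α s z) := by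
    intro i z
    by_cases hz : z ∈ O
    · have hz' : dil α s z ∈ (Ω : Set Space3) := hz
      rw [indicator_of_mem hz, indicator_of_mem hz', partialDeriv_comp_dil]
      exact (hv.contDiffOn.contDiffAt (Ω.isOpen.mem_nhds hz')).differentiableAt one_ne_zero
    · have hz' : dil α s z ∉ (Ω : Set Space3) := hz
      rw [indicator_of_notMem hz, indicator_of_notMem hz', mul_zero]
  obtain ⟨C, hC⟩ := hv.exists_bound
  have := weak_equation_of_eq_zero hΩ.isBounded hB hF hBK hFK hB0 hF0 h hOo hOΩ
    (hv.continuous.comp (dil α s).continuous)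
    (hasCompactSupport_of_eq_zero hΩ.isBounded fun z hz => hv0 z fun h => hz (hOΩ h))
    (hv.contDiffOn.comp (dil α s).contDiff.contDiffOn fun z hz => hz) hv0
    (C := (∑ i, |dilFactor α s i|) * C) fun i z => by
      have h1 : |dilFactor α s i| ≤ ∑ i, |dilFactor α s i| :=
        Finset.single_le_sum (f := fun i => |dilFactor α s i|) (fun _ _ => abs_nonneg _)
          (Finset.mem_univ i)
      have h2 := hpd i z
      simp only [Function.comp_def]
      rw [h2, abs_mul]
      exact mul_le_mul h1 (hC i _) (abs_nonneg _) ((abs_nonneg _).trans h1)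
  rw [← this]
  refine integral_congr_ae (Eventually.of_forall fun z => ?_)
  simp only [Function.comp_def, hpd]

/-- The displacement of the dilations. -/
theorem exists_norm_sub_dil_le (α : ℝ) {Ω : Opens Space3}
    (hΩ : Bornology.IsBounded (Ω : Set Space3)) : ∃ C : ℝ, 0 ≤ C ∧ ∀ s : ℝ, 1 ≤ s →
      1 ≤ s ^ (1 + α) → ∀ z ∈ Ω, dist z (dil α s z) ≤ C * ((s - 1) + (s ^ (1 + α) - 1)) := by
  obtain ⟨R, hR⟩ := hΩ.exists_norm_le
  refine ⟨(‖diagMap ![1, 1, 0]‖ + ‖diagMap ![0, 0, 1]‖) * |R|, by positivity,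
    fun s hs hs' z hz => ?_⟩
  have hzR : ‖z‖ ≤ |R| := (hR z hz).trans (le_abs_self R)
  have h1 : dil α s z - z =
      (s - 1) • diagMap ![1, 1, 0] z + (s ^ (1 + α) - 1) • diagMap ![0, 0, 1] z := by
    ext i
    fin_cases i <;> simp [dil, dilFactor] <;> ring
  have h2 : ∀ c : Fin 3 → ℝ, ‖diagMap c z‖ ≤ ‖diagMap c‖ * |R| := fun c =>
    (ContinuousLinearMap.le_opNorm _ _).trans (by gcongr)
  rw [dist_comm, dist_eq_norm, h1]
  refine (norm_add_le _ _).trans ?_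
  rw [norm_smul, norm_smul, Real.norm_of_nonneg (sub_nonneg.2 hs),
    Real.norm_of_nonneg (sub_nonneg.2 hs')]
  have h3 := mul_le_mul_of_nonneg_left (h2 ![1, 1, 0]) (sub_nonneg.2 hs)
  have h4 := mul_le_mul_of_nonneg_left (h2 ![0, 0, 1]) (sub_nonneg.2 hs')
  have h5 : 0 ≤ (s - 1) * (‖diagMap ![0, 0, 1]‖ * |R|) :=
    mul_nonneg (sub_nonneg.2 hs) (by positivity)
  have h6 : 0 ≤ (s ^ (1 + α) - 1) * (‖diagMap ![1, 1, 0]‖ * |R|) :=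
    mul_nonneg (sub_nonneg.2 hs') (by positivity)
  linarith

/-! ### Energy comparison -/

/-- The limit of the energy comparison as the dilation tends to the identity. -/
theorem energy_nonpos {a p E K : ℝ} (ha : 0 < a) (hp : 5 < p)
    (h : ∀ s : ℝ, 1 ≤ s → (1 - s ^ (-a)) / 2 * E ≤
      (1 - s ^ (-(3 * a))) / (p + 1) * E + K * ((s - 1) + (s ^ a - 1)) ^ 2) : E ≤ 0 := by
  have hr : ∀ b : ℝ, HasDerivAt (fun s : ℝ => s ^ b) b 1 := fun b => by
    simpa using Real.hasDerivAt_rpow_const (x := 1) (p := b) (Or.inl one_ne_zero)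
  have hsq : HasDerivAt (fun s : ℝ => K * ((s - 1) + (s ^ a - 1)) ^ 2) 0 1 := by
    have := ((((hasDerivAt_id (1 : ℝ)).sub_const 1).add ((hr a).sub_const 1)).pow 2).const_mul K
    simpa using this
  -- Right side minus left side of the hypothesis: zero at `s = 1` and nonnegative for `s ≥ 1`, so
  -- its derivative at `1` is nonnegative. The squared error term contributes nothing.
  have hG : HasDerivAt (fun s : ℝ => (1 - s ^ (-(3 * a))) / (p + 1) * E +
      K * ((s - 1) + (s ^ a - 1)) ^ 2 - (1 - s ^ (-a)) / 2 * E)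
      (3 * a / (p + 1) * E - a / 2 * E) 1 := by
    have := (((((hr (-(3 * a))).const_sub 1).div_const (p + 1)).mul_const E).add hsq).sub
      ((((hr (-a)).const_sub 1).div_const 2).mul_const E)
    exact this.congr_deriv (by simp)
  have hnn : 0 ≤ 3 * a / (p + 1) * E - a / 2 * E := by
    have h1 := (hasDerivWithinAt_iff_tendsto_slope' (notMem_Ioi.2 le_rfl)).1
      (hG.hasDerivWithinAt (s := Ioi 1))
    refine ge_of_tendsto h1 ?_
    filter_upwards [self_mem_nhdsWithin] with s hs
    have hs' : (1 : ℝ) < s := hs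
    rw [slope_def_field]
    refine div_nonneg ?_ (by linarith)
    have h2 := h s hs'.le
    simp
    linarith
  by_contra! hE
  -- For `a > 0` this is exactly `p > 5`.
  have h3 : 3 * a / (p + 1) < a / 2 := by
    rw [div_lt_div_iff₀ (by linarith) two_pos]
    nlinarith
  nlinarith [mul_lt_mul_of_pos_right h3 hE]

/-- A solution has zero energy. -/
theorem integral_weight_mul_rpow_eq_zero {α : ℝ} (hα : 0 < α) {p : ℝ} (hp : 5 < p)
    {Ω : Opens Space3} (hΩ : IsBoundedSmoothDomain Ω) (hstar : IsStarShaped α Ω)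
    {v : Space3 → ℝ} (hv : IsC10Extension Ω v)
    (hweak : ∀ φ : 𝓓(Ω, ℝ), ∫ z, (∑ i, coordWeight α i z *
      (Ω : Set Space3).indicator (partialDeriv i v) z * partialDeriv i φ z -
        weight α z * (|v z| ^ (p - 1) * v z) * φ z) = 0) :
    ∫ z, weight α z * |v z| ^ (p + 1) = 0 := by
  have hb := hΩ.isBounded
  have hW := continuous_weight hα
  have hvc := hv.continuous
  set D : Fin 3 → Space3 → ℝ := fun i => (Ω : Set Space3).indicator (partialDeriv i v) with hD
  set F : Space3 → ℝ := fun z => weight α z * (|v z| ^ (p - 1) * v z) with hF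
  set P : Space3 → ℝ := fun z => weight α z * |v z| ^ (p + 1) with hP
  set Q : Space3 → ℝ := fun z => ∑ i, coordWeight α i z * D i z ^ 2 with hQ
  set E := ∫ z, P z with hE
  have hFv : ∀ z, F z * v z = P z := fun z => by
    rcases eq_or_ne (v z) 0 with h0 | h0
    · simp [hF, hP, h0, Real.zero_rpow (by linarith : p + 1 ≠ 0)]
    · have h1 : |v z| ^ (p + 1) = |v z| ^ (p - 1) * (v z * v z) := by
        rw [show p + 1 = (p - 1) + 2 by ring, Real.rpow_add (abs_pos.2 h0), Real.rpow_two, sq_abs,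
          sq]
      simp only [hF, hP, h1]
      ring
  have hDm : ∀ i, Measurable (D i) := fun i =>
    (measurable_fderiv_apply_const ℝ v _).indicator Ω.isOpen.measurableSet
  have hD0 : ∀ i, ∀ z ∉ Ω, D i z = 0 := fun i z hz => indicator_of_notMem hz _
  have hFc : Continuous F := hW.mul
    ((hvc.abs.rpow_const fun _ => Or.inr (by linarith)).mul hvc)
  have hF0 : ∀ z ∉ Ω, F z = 0 := fun z hz => by simp [hF, hv.eq_zero z hz]
  have hPc : Continuous P := hW.mul (hvc.abs.rpow_const fun _ => Or.inr (by linarith))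
  have hP0 : ∀ z ∉ Ω, P z = 0 := fun z hz => by
    simp [hP, hv.eq_zero z hz, Real.zero_rpow (by linarith : p + 1 ≠ 0)]
  have hPnn : ∀ z, 0 ≤ P z := fun z =>
    mul_nonneg (weight_nonneg α z) (Real.rpow_nonneg (abs_nonneg _) _)
  have hbdd : ∀ g : Space3 → ℝ, Continuous g → (∀ z ∉ Ω, g z = 0) → ∃ C, ∀ z, |g z| ≤ C :=
    fun g hg h0 => (hasCompactSupport_of_eq_zero hb h0).exists_bound_of_continuous hg
  obtain ⟨CD, hCD⟩ := hv.exists_bound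
  obtain ⟨CF, hCF⟩ := hbdd F hFc hF0
  obtain ⟨CP, hCP⟩ := hbdd P hPc hP0
  obtain ⟨Cv, hCv⟩ := hbdd v hvc hv.eq_zero
  choose CW hCW using fun i => hb.isCompact_closure.exists_bound_of_continuousOn
    (continuous_coordWeight hα i).continuousOn
  have hCD0 : 0 ≤ CD := (abs_nonneg _).trans (hCD 0 0)
  obtain ⟨KW, hKW0, hKW⟩ : ∃ KW, 0 ≤ KW ∧ ∀ i, ∀ z ∈ Ω, |coordWeight α i z| ≤ KW := by
    refine ⟨∑ i, |CW i|, Finset.sum_nonneg fun _ _ => abs_nonneg _, fun i z hz => ?_⟩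
    exact ((hCW i z (subset_closure hz)).trans (le_abs_self _)).trans
      (Finset.single_le_sum (f := fun i => |CW i|) (fun _ _ => abs_nonneg _) (Finset.mem_univ i))
  set K := KW * CD + |CF| with hK
  have hBm : ∀ i, Measurable fun z => coordWeight α i z * D i z := fun i =>
    (continuous_coordWeight hα i).measurable.mul (hDm i)
  have hBK : ∀ i z, |coordWeight α i z * D i z| ≤ K := fun i z => by
    by_cases hz : z ∈ Ω
    · rw [abs_mul]
      exact (mul_le_mul (hKW i z hz) (hCD i z) (abs_nonneg _) hKW0).trans
        (le_add_of_nonneg_right (abs_nonneg _))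
    · rw [hD0 i z hz, mul_zero, abs_zero]
      positivity
  have hFK : ∀ z, |F z| ≤ K := fun z => ((hCF z).trans (le_abs_self _)).trans
    (le_add_of_nonneg_left (mul_nonneg hKW0 hCD0))
  have hB0 : ∀ i, ∀ z ∉ Ω, coordWeight α i z * D i z = 0 := fun i z hz => by
    rw [hD0 i z hz, mul_zero]
  have htest := fun {s : ℝ} (hs : 1 ≤ s) => hv.weak_equation_comp_dil hΩ hstar hBm hFc.measurable
    hBK hFK hB0 hF0 hweak hs
  have hQm : Measurable Q := Finset.measurable_sum _ fun i _ =>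
    (continuous_coordWeight hα i).measurable.mul ((hDm i).pow_const 2)
  have hQ0 : ∀ z ∉ Ω, Q z = 0 := fun z hz => by simp [hQ, hD0 _ z hz]
  have hQK : ∀ z, |Q z| ≤ 4 * (K * CD) := fun z => by
    have := abs_sum_mul_sub_mul_le (fun i => hBK i z) (hFK z) (fun i => hCD i z)
      (Y := 0) (by simpa using hCD0)
    simpa [hQ, sq, mul_assoc] using this
  have hPint : Integrable P := integrable_of_bounded hb hPc.measurable hCP hP0
  have hQint : Integrable Q := integrable_of_bounded hb hQm hQK hQ0
  have hQE : ∫ z, Q z = E := by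
    -- Taking `s = 1` tests the equation with `v` itself.
    have h1 := htest le_rfl
    have h2 : ∀ z, ∑ i, coordWeight α i z * D i z * (dilFactor α 1 i * D i (dil α 1 z)) -
        F z * v (dil α 1 z) = Q z - P z := fun z => by
      rw [dil_one, hFv]
      congr 1
      refine Finset.sum_congr rfl fun i _ => ?_
      have : dilFactor α 1 i = 1 := by fin_cases i <;> simp [dilFactor]
      rw [this]
      ring
    have h3 : ∫ z, (Q z - P z) = 0 := by
      rw [← h1]
      exact integral_congr_ae (Eventually.of_forall fun z => (h2 z).symm)
    rw [integral_sub hQint hPint] at h3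
    linarith
  obtain ⟨L, hL⟩ := hv.exists_lipschitzWith hb
  obtain ⟨C₁, hC₁, hdisp⟩ := exists_norm_sub_dil_le α hb
  obtain ⟨K₁, hK₁, hpow⟩ := exists_abs_rpow_mul_sub_le (by linarith : 2 < p) Cv
  set I := ∫ z, (Ω : Set Space3).indicator (fun _ => (1 : ℝ)) z with hI
  have hEnn : 0 ≤ E := integral_nonneg hPnn
  -- In the error constant, `L * C₁` converts the displacement into a bound for `|v - v ∘ dil α s|`,
  -- `K₁` comes from the expansion of the power, `KW` bounds the weight and `I` is the volume of
  -- `Ω`.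
  refine le_antisymm (energy_nonpos (a := 1 + α) (p := p)
    (K := K₁ * KW * (L * C₁) ^ 2 * I) (by linarith) hp fun s hs => ?_) hEnn
  have hs0 : 0 < s := by linarith
  have hout : ∀ z ∉ Ω, dil α s z ∉ Ω := fun z hz h => hz (mem_of_dil_mem hΩ hstar hs h)
  have hdilm : Measurable fun z => dil α s z := (dil α s).continuous.measurable
  have hPs : Integrable fun z => P (dil α s z) := integrable_of_bounded hb
    (hPc.measurable.comp hdilm) (fun z => hCP _) fun z hz => hP0 _ (hout z hz)
  have hQs : Integrable fun z => Q (dil α s z) := integrable_of_bounded hb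
    (hQm.comp hdilm) (fun z => hQK _) fun z hz => hQ0 _ (hout z hz)
  have hFs : Integrable fun z => F z * v (dil α s z) :=
    (hFc.mul (hvc.comp (dil α s).continuous)).integrable_of_hasCompactSupport
      (hasCompactSupport_of_eq_zero hb hF0).mul_right
  -- Young's inequality applied to each term of the gradient form. The energy of the dilated
  -- function is `s ^ 2 * s ^ (-(3 + α)) * E`, hence the exponent `-(1 + α)`.
  have hlower : ∫ z, F z * v (dil α s z) ≤ (1 / 2) * E + (1 / 2) * (s ^ (-(1 + α)) * E) := by
    have hpt : ∀ z, ∑ i, coordWeight α i z * D i z * (dilFactor α s i * D i (dil α s z)) -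
        F z * v (dil α s z) ≤
        (1 / 2) * Q z + (1 / 2) * (s ^ 2 * Q (dil α s z)) - F z * v (dil α s z) := fun z => by
      refine sub_le_sub_right ?_ _
      simp only [hQ, Finset.mul_sum, ← Finset.sum_add_distrib]
      refine Finset.sum_le_sum fun i _ => ?_
      rw [← mul_assoc (s ^ 2), ← coordWeight_mul_dilFactor_sq α hs0]
      nlinarith [mul_nonneg (coordWeight_nonneg α i z)
        (sq_nonneg (D i z - dilFactor α s i * D i (dil α s z)))]
    have hint : Integrable fun z =>
        ∑ i, coordWeight α i z * D i z * (dilFactor α s i * D i (dil α s z)) -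
          F z * v (dil α s z) := by
      refine Integrable.sub (integrable_finsetSum _ fun i _ => ?_) hFs
      refine integrable_of_bounded hb (C := K * (|dilFactor α s i| * CD))
        ((hBm i).mul (((hDm i).comp hdilm).const_mul _)) (fun z => ?_)
        fun z hz => by rw [hB0 i z hz, zero_mul]
      rw [abs_mul, abs_mul (dilFactor α s i)]
      exact mul_le_mul (hBK i z) (mul_le_mul_of_nonneg_left (hCD i _) (abs_nonneg _))
        (by positivity) ((abs_nonneg _).trans (hFK z))
    have h12 : Integrable fun z => (1 / 2) * Q z + (1 / 2) * (s ^ 2 * Q (dil α s z)) :=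
      (hQint.const_mul _).add ((hQs.const_mul _).const_mul _)
    have h1 := integral_mono hint (h12.sub hFs) hpt
    rw [htest hs, integral_sub' h12 hFs, integral_add (hQint.const_mul _)
      ((hQs.const_mul _).const_mul _), integral_const_mul, integral_const_mul, integral_const_mul,
      integral_comp_dil α hs0 hQm, hQE] at h1
    have h2 : s ^ 2 * (s ^ (-(3 + α)) * E) = s ^ (-(1 + α)) * E := by
      rw [← mul_assoc, ← Real.rpow_two, ← Real.rpow_add hs0]
      congr 2
      ring
    rw [h2] at h1
    linarith
  -- The exponent `-(3 * (1 + α))` combines `-(2 * α)` from the weight with `-(3 + α)` from the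
  -- Jacobian.
  have hupper : E - ∫ z, F z * v (dil α s z) ≤ (1 / (p + 1)) * (E - s ^ (-(3 * (1 + α))) * E) +
      K₁ * KW * (L * C₁) ^ 2 * ((s - 1) + (s ^ (1 + α) - 1)) ^ 2 * I := by
    set e := (s - 1) + (s ^ (1 + α) - 1) with he
    have hs1 : 1 ≤ s ^ (1 + α) := Real.one_le_rpow hs (by linarith)
    have hpt : ∀ z, P z - F z * v (dil α s z) ≤
        (1 / (p + 1)) * (P z - s ^ (-(2 * α)) * P (dil α s z)) +
          K₁ * KW * (L * C₁) ^ 2 * e ^ 2 * (Ω : Set Space3).indicator (fun _ => (1 : ℝ)) z := by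
      intro z
      by_cases hz : z ∈ Ω
      · have h1 := mul_le_mul_of_nonneg_left (hpow (v z) (v (dil α s z)) (hCv _) (hCv _))
          (weight_nonneg α z)
        have h2 : s ^ (-(2 * α)) * P (dil α s z) = weight α z * |v (dil α s z)| ^ (p + 1) := by
          simp only [hP]
          rw [weight_dil α hs0.le, ← mul_assoc, ← mul_assoc, ← Real.rpow_add hs0]
          simp
        have h3 : (v z - v (dil α s z)) ^ 2 ≤ (L * C₁) ^ 2 * e ^ 2 := by
          rw [← mul_pow, ← sq_abs]
          refine pow_le_pow_left₀ (abs_nonneg _) ?_ 2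
          rw [← Real.dist_eq, mul_assoc]
          exact (hL.dist_le_mul _ _).trans
            (mul_le_mul_of_nonneg_left (hdisp s hs hs1 z hz) L.2)
        have h4 : weight α z ≤ KW := (le_abs_self _).trans (hKW 2 z hz)
        have h5 : weight α z * (K₁ * (v z - v (dil α s z)) ^ 2) ≤
            KW * (K₁ * ((L * C₁) ^ 2 * e ^ 2)) := by
          gcongr
        have hz' : z ∈ (Ω : Set Space3) := hz
        rw [indicator_of_mem hz', h2, ← hFv]
        have h6 : P z = weight α z * |v z| ^ (p + 1) := rfl
        have h7 : F z * v z - F z * v (dil α s z) =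
            weight α z * (|v z| ^ (p - 1) * v z * (v z - v (dil α s z))) := by
          simp only [hF]
          ring
        rw [h7, hFv, h6]
        refine h1.trans ?_
        rw [mul_add]
        refine add_le_add (le_of_eq ?_) (h5.trans_eq (by ring))
        ring
      · have hz' : z ∉ (Ω : Set Space3) := hz
        rw [indicator_of_notMem hz', hP0 z hz, hF0 z hz, hP0 _ (hout z hz)]
        simp
    have hsub : Integrable fun z => P z - s ^ (-(2 * α)) * P (dil α s z) :=
      hPint.sub (hPs.const_mul _)
    have h1 := integral_mono (hPint.sub hFs) ((hsub.const_mul (1 / (p + 1))).add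
      ((integrable_indicator_const hb 1).const_mul (K₁ * KW * (L * C₁) ^ 2 * e ^ 2))) hpt
    rw [integral_sub' hPint hFs, integral_add' (hsub.const_mul _)
      ((integrable_indicator_const hb 1).const_mul _), integral_const_mul, integral_const_mul,
      integral_sub hPint (hPs.const_mul _), integral_const_mul,
      integral_comp_dil α hs0 hPc.measurable] at h1
    have h2 : s ^ (-(2 * α)) * (s ^ (-(3 + α)) * E) = s ^ (-(3 * (1 + α))) * E := by
      rw [← mul_assoc, ← Real.rpow_add hs0]
      congr 2
      ring
    rw [h2] at h1
    exact h1
  have h8 : (1 - s ^ (-(3 * (1 + α)))) / (p + 1) * E =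
      (1 / (p + 1)) * (E - s ^ (-(3 * (1 + α))) * E) := by ring
  rw [h8]
  linarith

/-! ### From zero energy to the zero function -/

theorem eq_zero_of_integral_weight_mul_rpow_eq_zero {α : ℝ} (hα : 0 < α) {p : ℝ} (hp : 5 < p)
    {v : Space3 → ℝ} (hv : Continuous v) (hvs : HasCompactSupport v)
    (h : ∫ z, weight α z * |v z| ^ (p + 1) = 0) (z : Space3) : v z = 0 := by
  have hp1 : p + 1 ≠ 0 := by linarith
  have hPc : Continuous fun z => weight α z * |v z| ^ (p + 1) :=
    (continuous_weight hα).mul (hv.abs.rpow_const fun _ => Or.inr (by linarith))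
  have hPs : HasCompactSupport fun z => weight α z * |v z| ^ (p + 1) :=
    (hvs.comp_left (g := fun t : ℝ => |t| ^ (p + 1)) (by simp [Real.zero_rpow hp1])).mul_left
  have hzero : ∀ z, weight α z * |v z| ^ (p + 1) = 0 := by
    by_contra! hne
    obtain ⟨z, hz⟩ := hne
    exact (hPc.integral_pos_of_hasCompactSupport_nonneg_nonzero hPs
      (fun z => mul_nonneg (weight_nonneg α z) (Real.rpow_nonneg (abs_nonneg _) _)) hz).ne' h
  by_contra hz
  have hc : Continuous fun t : ℝ => v (z + t • EuclideanSpace.single 0 (1 : ℝ)) := by fun_prop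
  -- If `v z ≠ 0`, a shift of `z` in the direction `x₁` with `t ≠ -z 0` leaves the axis, where the
  -- weight degenerates, and keeps `v` nonzero.
  obtain ⟨t, ht, ht'⟩ := (dense_compl_singleton (-z 0)).exists_mem_open
    (isOpen_ne_fun hc continuous_const) ⟨0, by simpa using hz⟩
  set y := z + t • EuclideanSpace.single 0 (1 : ℝ) with hy
  have h0 : y 0 ≠ 0 := by
    intro h0
    apply ht
    simp [hy] at h0
    rw [mem_singleton_iff]
    linarith
  have hw : 0 < weight α y := by
    refine Real.rpow_pos_of_pos (Real.sqrt_pos.2 ?_) _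
    positivity
  rcases mul_eq_zero.1 (hzero y) with h1 | h1
  · exact hw.ne' h1
  · exact ht' (abs_eq_zero.1 ((Real.rpow_eq_zero (abs_nonneg _) hp1).1 h1))

end Grushin

theorem mainTheorem6 (α : ℝ) (hα : 0 < α) (p : ℝ) (hp : 5 < p)
    (Ω : TopologicalSpace.Opens Grushin.Space3) (hΩ : Grushin.IsBoundedSmoothDomain Ω)
    (hstar : Grushin.IsStarShaped α Ω) :
    ¬ ∃ u : Grushin.Space3 → ℝ, Grushin.MemS2 α Ω u ∧
      Grushin.IsSolution α Ω (fun z ξ => Grushin.weight α z * (|ξ| ^ (p - 1) * ξ)) u ∧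
      ∃ z ∈ closure (Ω : Set Grushin.Space3), u z ≠ 0 := by
  rintro ⟨u, ⟨hu, -⟩, hsol, z, hz, hne⟩
  have hv := hu.isC10Extension_indicator hΩ.isBounded
  have hE := Grushin.integral_weight_mul_rpow_eq_zero hα hp hΩ hstar hv fun φ =>
    hsol.weak_equation hα hΩ.isBounded hv (fun z hz => by
      have hz' : z ∈ (Ω : Set Grushin.Space3) := hz
      rw [Set.indicator_of_mem hz']) φ
  have h0 := Grushin.eq_zero_of_integral_weight_mul_rpow_eq_zero hα hp hv.continuous
    (Grushin.hasCompactSupport_of_eq_zero hΩ.isBounded hv.eq_zero) hE z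
  by_cases hzΩ : z ∈ (Ω : Set Grushin.Space3)
  · rw [Set.indicator_of_mem hzΩ] at h0
    exact hne h0
  · refine hne (hu.eq_zero_of_mem_frontier z ?_)
    rw [Ω.isOpen.frontier_eq]
    exact ⟨hz, hzΩ⟩
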